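/- Let $X$ be a finite-dimensional real normed space, $T>0$, and let $\Psi_0:X\to[0,\infty)$ satisfy $\Psi_0(v)>0$ for $v\ne0$, $\Psi_0(v+w)\le\Psi_0(v)+\Psi_0(w)$ and $\Psi_0(\lambda v)=\lambda\Psi_0(v)$ for all $\lambda\ge0$, $v,w\in X$. Let $\partial\Psi_0$ be its convex subdifferential and $K^*=\partial\Psi_0(0)=\{w\in X^*:\langle w,z\rangle\le\Psi_0(z)\ \forall z\in X\}$. Let $\mathcal E\in C^1([0,T]\times X)$, $(t,x)\mapsto\mathcal E_t(x)$, be such that for some $C>0$ one has $\mathcal E_t(x)\ge -C$ and $|\partial_t\mathcal E_t(x)|\le C(1+\mathcal E_t(x)^+)$ for all $(t,x)\in[0,T]\times X$; $\mathrm D\mathcal E_t$ denotes the differential in $x$. Let $u:[0,T]\to X$ be a curve, defined at every point, of bounded (pointwise) variation. Put $$\mathrm{Var}_{\Psi_0}(u;a,b)=\sup\Big\{\sum_{m=1}^M\Psi_0(u(t_m)-u(t_{m-1})):\ a=t_0<\dots<t_M=b\Big\}.$$ Let $u(t_\pm)$ be the right and left limits, with the conventions $u(0_-)=u(0)$, $u(T_+)=u(T)$,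 and let $\mathrm J_u=\{t\in[0,T]:u(t_-)\ne u(t)\text{ or }u(t)\ne u(t_+)\}$. Let $u'=u'_{\mathscr L}+u'_{\mathrm C}+u'_{\mathrm J}$ be the decomposition of the distributional derivative of $u$ on $(0,T)$ (an $X$-valued Radon measure) into its part absolutely continuous with respect to the Lebesgue measure $\mathscr L^1$, its Cantor part (singular with respect to $\mathscr L^1$, without atoms) and its jump part (concentrated on $\{t:u(t_-)\neq u(t_+)\}$). Put $u'_{\mathrm{co}}=u'_{\mathscr L}+u'_{\mathrm C}$ and $\mu=\mathscr L^1+|u'_{\mathrm C}|$ on $(0,T)$. The curve $u$ is called a local solution if $$-\mathrm D\mathcal E_t(u(t))\in K^*\quad\text{for every }t\in[0,T]\setminus\mathrm J_u$$ and, for all $0\le t_0<t_1\le T$, $$\mathcal E_{t_1}(u(t_1))+\mathrm{Var}_{\Psi_0}(u;t_0,t_1)\le\mathcal E_{t_0}(u(t_0))+\int_{t_0}^{t_1}\partial_t\mathcal E_t(u(t))\,\mathrm dt .$$ Then $u$ is a local solution if and only if it satisfies the differential inclusion $$\partial\Psi_0\Big(\frac{\mathrm du'_{\mathrm{co}}}{\mathrm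 d\mu}(t)\Big)+\mathrm D\mathcal E_t(u(t))\ni0\quad\text{for }\mu\text{-a.e. }t\in(0,T)$$ and, at every $t\in\mathrm J_u$, the jump inequalities $$\mathcal E_t(u(t))-\mathcal E_t(u(t_-))\le-\Psi_0(u(t)-u(t_-)),\qquad \mathcal E_t(u(t_+))-\mathcal E_t(u(t))\le-\Psi_0(u(t_+)-u(t)),$$ $$\mathcal E_t(u(t_+))-\mathcal E_t(u(t_-))\le-\Psi_0(u(t_+)-u(t_-)).$$ -/

import Mathlib

open Set MeasureTheory Filter Topology
open scoped ENNReal ContDiff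

namespace RIS

/-! ### The rate-independent system `(X, E, Ψ₀)` -/

/-- A gauge function: a non-degenerate, subadditive, positively `1`-homogeneous dissipation
`Ψ₀ : X → [0, ∞)`. -/
structure IsGauge {X : Type*} [NormedAddCommGroup X] [NormedSpace ℝ X] (Ψ : X → ℝ) : Prop where
  nonneg : ∀ v, 0 ≤ Ψ v
  pos : ∀ v, v ≠ 0 → 0 < Ψ v
  add_le : ∀ v w, Ψ (v + w) ≤ Ψ v + Ψ w
  smul : ∀ (c : ℝ) (v : X), 0 ≤ c → Ψ (c • v) = c * Ψ v

/-- The convex subdifferential `∂Ψ(v) ⊆ X*`. -/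
def subdifferential {X : Type*} [NormedAddCommGroup X] [NormedSpace ℝ X]
    (Ψ : X → ℝ) (v : X) : Set (StrongDual ℝ X) :=
  {w | ∀ z, Ψ v + w (z - v) ≤ Ψ z}

/-- The stable set `K* = {w ∈ X* : ⟨w, z⟩ ≤ Ψ(z) for all z}`. -/
def stableSet {X : Type*} [NormedAddCommGroup X] [NormedSpace ℝ X]
    (Ψ : X → ℝ) : Set (StrongDual ℝ X) :=
  {w | ∀ z, w z ≤ Ψ z}

/-- The partial time derivative `∂ₜE_t(x)`, one-sided at the end points of `[0, T]`. -/
noncomputable def timeDeriv {X : Type*} (T : ℝ) (E : ℝ → X → ℝ) (t : ℝ) (x : X) : ℝ :=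
  derivWithin (fun s => E s x) (Icc 0 T) t

/-- The differential `D E_t(x) ∈ X*` in the state variable. -/
noncomputable def stateDeriv {X : Type*} [NormedAddCommGroup X] [NormedSpace ℝ X]
    (E : ℝ → X → ℝ) (t : ℝ) (x : X) : StrongDual ℝ X :=
  fderiv ℝ (E t) x

/-- The energy `E` belongs to `C¹([0, T] × X)`, is bounded from below, and its time derivative is
controlled by the energy. -/
structure IsEnergy {X : Type*} [NormedAddCommGroup X] [NormedSpace ℝ X]
    (T : ℝ) (E : ℝ → X → ℝ) : Prop where
  contDiffOn : ContDiffOn ℝ 1 (fun p : ℝ × X => E p.1 p.2) (Icc 0 T ×ˢ univ)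
  bounds : ∃ C : ℝ, 0 < C ∧ ∀ t ∈ Icc 0 T, ∀ x,
    -C ≤ E t x ∧ |timeDeriv T E t x| ≤ C * (1 + max (E t x) 0)

/-! ### Curves of bounded variation on `[0, T]`

A curve is a function `u : ℝ → X` of which only the values on `[0, T]` matter. -/

/-- The pointwise `Ψ`-variation on `[a, b]`: the supremum of `∑ Ψ(u(t_m) - u(t_{m-1}))` over all
partitions `a = t_0 ≤ t_1 ≤ ⋯ ≤ t_M = b` (repeated points contribute `Ψ(0) = 0`). -/
noncomputable def psiVar {X : Type*} [NormedAddCommGroup X]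
    (Ψ : X → ℝ) (u : ℝ → X) (a b : ℝ) : ℝ≥0∞ :=
  ⨆ (M : ℕ) (t : ℕ → ℝ) (_ : Monotone t ∧ t 0 = a ∧ t M = b),
    ∑ m ∈ Finset.range M, ENNReal.ofReal (Ψ (u (t (m + 1)) - u (t m)))

/-- The extension of `u|_[0,T]` which is constant on `(-∞, 0]` and on `[T, ∞)`. -/
def extend {X : Type*} (T : ℝ) (u : ℝ → X) (t : ℝ) : X := u (max 0 (min t T))

/-- The left limit `u(t₋)`, with the convention `u(0₋) = u(0)`. -/
noncomputable def left {X : Type*} [TopologicalSpace X] (T : ℝ) (u : ℝ → X) (t : ℝ) : X :=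
  Function.leftLim (extend T u) t

/-- The right limit `u(t₊)`, with the convention `u(T₊) = u(T)`. -/
noncomputable def right {X : Type*} [TopologicalSpace X] (T : ℝ) (u : ℝ → X) (t : ℝ) : X :=
  Function.rightLim (extend T u) t

/-- The pointwise jump set `J_u`. -/
def jumpSet {X : Type*} [TopologicalSpace X] (T : ℝ) (u : ℝ → X) : Set ℝ :=
  {t ∈ Icc 0 T | left T u t ≠ u t ∨ u t ≠ right T u t}

/-- The essential jump set `ess-J_u`. -/
def essJumpSet {X : Type*} [TopologicalSpace X] (T : ℝ) (u : ℝ → X) : Set ℝ :=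
  {t ∈ Icc 0 T | left T u t ≠ right T u t}

theorem extend_bv {X : Type*} [NormedAddCommGroup X] {T : ℝ} (hT : 0 ≤ T) {u : ℝ → X}
    (hu : BoundedVariationOn u (Icc 0 T)) : BoundedVariationOn (extend T u) univ := by
  refine ne_top_of_le_ne_top hu ?_
  refine eVariationOn.comp_le_of_monotoneOn u (fun t => max 0 (min t T)) ?_ ?_
  · intro a _ b _ hab
    exact max_le_max le_rfl (min_le_min hab le_rfl)
  · intro t _
    exact ⟨le_max_left _ _, max_le hT (min_le_right _ _)⟩

/-- The distributional derivative `u'` of `u` on `(0, T)`, as an `X`-valued measure: the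
Stieltjes vector measure of `u` restricted to `(0, T)`. It is characterized by
`u'((a, b]) = u(b₊) - u(a₊)` for `0 < a ≤ b < T`;
see `integral_deriv_smul` for the integration by parts formula against test functions. -/
noncomputable def bvDeriv {X : Type*} [NormedAddCommGroup X] [NormedSpace ℝ X]
    [FiniteDimensional ℝ X] {T : ℝ} (hT : 0 ≤ T) {u : ℝ → X}
    (hu : BoundedVariationOn u (Icc 0 T)) : VectorMeasure ℝ X :=
  (extend_bv hT hu).vectorMeasure.restrict (Ioo 0 T)

/-- A vector measure in a finite-dimensional space has finite total variation. -/
theorem isFiniteMeasure_variation {X : Type*} [NormedAddCommGroup X] [NormedSpace ℝ X]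
    [FiniteDimensional ℝ X] (ν : VectorMeasure ℝ X) : IsFiniteMeasure ν.variation := by
  let b := Module.finBasis ℝ X
  let c : Fin (Module.finrank ℝ X) → X →L[ℝ] ℝ := fun i => (b.coord i).toContinuousLinearMap
  let σ : Fin (Module.finrank ℝ X) → SignedMeasure ℝ := fun i =>
    ν.mapRange (c i).toLinearMap.toAddMonoidHom (c i).continuous
  have hle : ν.variation ≤ ∑ i, ‖b i‖₊ • (σ i).totalVariation := by
    apply VectorMeasure.variation_le_of_forall_enorm_le
    intro s hs
    have h1 : ν s = ∑ i, (σ i s) • b i := (b.sum_repr (ν s)).symm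
    rw [h1, Measure.finsetSum_apply]
    refine (enorm_sum_le _ _).trans (Finset.sum_le_sum fun i _ => ?_)
    rw [enorm_smul, mul_comm]
    exact mul_le_mul_right (SignedMeasure.enorm_le_totalVariation (σ i) s) _
  exact isFiniteMeasure_of_le _ hle

/-- Fubini: integrating the tails of `g ≥ 0` against `ν`. -/
theorem integral_tail_smul {X : Type*} [NormedAddCommGroup X] [NormedSpace ℝ X]
    [FiniteDimensional ℝ X] (ν : VectorMeasure ℝ X) {g : ℝ → ℝ} (hg : Integrable g)
    (hg0 : ∀ s, 0 ≤ g s) (hgm : Measurable g) :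
    VectorMeasure.Integrable ν (fun t => ∫ s in Ioi t, g s) ∧
    Integrable (fun s => g s • ν (Iio s)) ∧
    VectorMeasure.integral ν (fun t => ∫ s in Ioi t, g s) (ContinuousLinearMap.lsmul ℝ ℝ) =
      ∫ s, g s • ν (Iio s) := by
  have := isFiniteMeasure_variation ν
  let κ : Measure ℝ := volume.withDensity (fun s => ENNReal.ofReal (g s))
  have : IsFiniteMeasure κ := isFiniteMeasure_withDensity_ofReal hg.2
  let B : ℝ →L[ℝ] X →L[ℝ] X := ContinuousLinearMap.lsmul ℝ ℝ
  let S : Set (ℝ × ℝ) := {p | p.2 < p.1}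
  have hS : MeasurableSet S := measurableSet_lt measurable_snd measurable_fst
  have : IsFiniteMeasure κ.toSignedMeasure.variation := by
    rw [Measure.variation_toSignedMeasure]; infer_instance
  have e1 := VectorMeasure.prod_apply_eq_integral (μ := κ.toSignedMeasure) (ν := ν) (B := B) hS
  have e2 := VectorMeasure.prod_flip_apply_eq_integral (μ := ν) (ν := κ.toSignedMeasure)
    (B := B) (hS.preimage measurable_swap)
  have e3 : ν.prod κ.toSignedMeasure B.flip = (κ.toSignedMeasure.prod ν B).map Prod.swap := by
    apply VectorMeasure.prod_eq_of_forall_apply_prod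
    intro s t hs ht
    rw [VectorMeasure.map_apply _ measurable_swap (hs.prod ht)]
    simp
  have e4 : ν.prod κ.toSignedMeasure B.flip (Prod.swap ⁻¹' S) = κ.toSignedMeasure.prod ν B S := by
    rw [e3, VectorMeasure.map_apply _ measurable_swap (hS.preimage measurable_swap)]
    rfl
  have e5 : (fun t => κ.toSignedMeasure (Prod.mk t ⁻¹' (Prod.swap ⁻¹' S))) =
      fun t => ∫ s in Ioi t, g s := by
    funext t
    have : Prod.mk t ⁻¹' (Prod.swap ⁻¹' S) = Ioi t := rfl
    rw [this, Measure.toSignedMeasure_apply_measurable measurableSet_Ioi, Measure.real,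
      withDensity_apply _ measurableSet_Ioi,
      integral_eq_lintegral_of_nonneg_ae (Eventually.of_forall hg0) hgm.aestronglyMeasurable]
  have i1 := VectorMeasure.integrable_vectorMeasure_prodMk_left (μ := κ.toSignedMeasure)
    (ν := ν) hS
  have i2 := VectorMeasure.integrable_vectorMeasure_prodMk_left (μ := ν)
    (ν := κ.toSignedMeasure) (hS.preimage measurable_swap)
  rw [e5] at e2 i2
  have e6 : (fun s => ν (Prod.mk s ⁻¹' S)) = fun s => ν (Iio s) := rfl
  rw [e6] at e1 i1
  rw [VectorMeasure.Integrable, Measure.variation_toSignedMeasure,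
    integrable_withDensity_iff_integrable_smul' (by fun_prop) (by simp)] at i1
  simp only [ENNReal.toReal_ofReal (hg0 _)] at i1
  refine ⟨i2, i1, ?_⟩
  rw [← e2, e4, e1]
  have e7 := VectorMeasure.integral_toSignedMeasure (μ := κ) (f := fun s => ν (Iio s))
  refine e7.trans ?_
  rw [integral_withDensity_eq_integral_toReal_smul (by fun_prop) (by simp)]
  simp only [ENNReal.toReal_ofReal (hg0 _)]

/-- `bvDeriv` is the distributional derivative: `∫ φ' u dt = -∫ φ du'` for every test function
`φ ∈ C_c^∞(0, T)`. -/
theorem integral_deriv_smul {X : Type*} [NormedAddCommGroup X] [NormedSpace ℝ X]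
    [FiniteDimensional ℝ X] {T : ℝ} (hT : 0 ≤ T) {u : ℝ → X}
    (hu : BoundedVariationOn u (Icc 0 T)) {φ : ℝ → ℝ} (hφ : ContDiff ℝ ∞ φ)
    (hc : HasCompactSupport φ) (hs : tsupport φ ⊆ Ioo 0 T) :
    ∫ t in Ioo 0 T, deriv φ t • u t =
      -VectorMeasure.integral (bvDeriv hT hu) φ (ContinuousLinearMap.lsmul ℝ ℝ) := by
  set ν := bvDeriv hT hu with hν
  have hφ1 : ContDiff ℝ 1 φ := hφ.of_le (by exact_mod_cast le_top)
  have hd : Continuous (deriv φ) := hφ1.continuous_deriv le_rfl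
  have hdi : Integrable (deriv φ) := hd.integrable_of_hasCompactSupport hc.deriv
  have hz : ∀ t, t ∉ Ioo 0 T → deriv φ t = 0 := fun t ht => by
    by_contra h
    exact ht (hs (support_deriv_subset h))
  have hIoi : ∀ t, ∫ s in Ioi t, deriv φ s = -φ t := fun t => hc.integral_Ioi_deriv_eq hφ1 t
  obtain ⟨a1, a2, a3⟩ := integral_tail_smul ν (g := fun s => max (deriv φ s) 0)
    hdi.pos_part (fun s => le_max_right _ _) (by fun_prop)
  obtain ⟨b1, b2, b3⟩ := integral_tail_smul ν (g := fun s => max (-deriv φ s) 0)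
    hdi.neg_part (fun s => le_max_right _ _) (by fun_prop)
  have hpm : ∀ x : ℝ, max x 0 - max (-x) 0 = x := fun x => by
    rcases le_total 0 x with h | h
    · rw [max_eq_left h, max_eq_right (by linarith)]; ring
    · rw [max_eq_right h, max_eq_left (by linarith)]; ring
  have hneg : VectorMeasure.integral ν φ (ContinuousLinearMap.lsmul ℝ ℝ) =
      -(∫ s, deriv φ s • ν (Iio s)) := by
    have h1 := VectorMeasure.integral_fun_sub (B := ContinuousLinearMap.lsmul ℝ ℝ (E := X)) b1 a1
    have h2 : (fun t => (∫ s in Ioi t, max (-deriv φ s) 0) - ∫ s in Ioi t, max (deriv φ s) 0)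
        = φ := by
      funext t
      rw [← integral_sub hdi.neg_part.integrableOn hdi.pos_part.integrableOn, ← neg_inj, ← hIoi,
        ← integral_neg]
      exact integral_congr_ae (Eventually.of_forall fun s => by simp [hpm])
    rw [h2, a3, b3, ← integral_sub b2 a2] at h1
    rw [h1, ← integral_neg]
    refine integral_congr_ae (Eventually.of_forall fun s => ?_)
    simp only [← sub_smul, ← neg_smul]
    rw [← neg_sub, hpm]
  have hint : Integrable (fun s => deriv φ s • ν (Iio s)) := by
    refine (a2.sub b2).congr (Eventually.of_forall fun s => ?_)
    simp only [Pi.sub_apply, ← sub_smul, hpm]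
  set c := Function.rightLim (extend T u) 0
  have hcont : ∀ᵐ s : ℝ, Function.leftLim (extend T u) s = extend T u s := by
    have := (extend_bv hT hu).locallyBoundedVariationOn.ae_differentiableAt
    filter_upwards [this] with s hs
    exact hs.continuousAt.continuousWithinAt.leftLim_eq
  have hae : ∀ᵐ s : ℝ, (Ioo 0 T).indicator (fun s => deriv φ s • u s) s =
      deriv φ s • ν (Iio s) + deriv φ s • c := by
    filter_upwards [hcont] with s h
    by_cases hs' : s ∈ Ioo 0 T
    · rw [indicator_of_mem hs', ← smul_add, hν, bvDeriv,
        VectorMeasure.restrict_apply _ measurableSet_Ioo measurableSet_Iio]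
      have : Iio s ∩ Ioo 0 T = Ioo 0 s := by
        ext x; simp only [mem_inter_iff, mem_Iio, mem_Ioo]
        exact ⟨fun h => ⟨h.2.1, h.1⟩, fun h => ⟨h.2, h.1, h.2.trans hs'.2⟩⟩
      rw [this, (extend_bv hT hu).vectorMeasure_Ioo hs'.1, h, sub_add_cancel]
      simp [extend, min_eq_left hs'.2.le, max_eq_right hs'.1.le]
    · rw [indicator_of_notMem hs', hz s hs']; simp
  rw [hneg, neg_neg, ← integral_indicator measurableSet_Ioo, integral_congr_ae hae,
    integral_add hint (hdi.smul_const c), integral_smul_const]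
  rw [integral_eq_zero_of_hasDerivAt_of_integrable (f := φ)
    (fun x => (hφ1.differentiable one_ne_zero x).hasDerivAt) hdi (hφ.continuous.integrable_of_hasCompactSupport hc)]
  simp

/-- The decomposition `u' = u'_L + u'_C + u'_J` of the derivative into its absolutely continuous
part, its Cantor part and its jump part. -/
structure IsBVDecomposition {X : Type*} [NormedAddCommGroup X] [NormedSpace ℝ X]
    [FiniteDimensional ℝ X] {T : ℝ} (hT : 0 ≤ T) {u : ℝ → X}
    (hu : BoundedVariationOn u (Icc 0 T)) (uL uC uJ : VectorMeasure ℝ X) : Prop where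
  sum_eq : bvDeriv hT hu = uL + uC + uJ
  ac : uL ≪ᵥ (volume : Measure ℝ).toENNRealVectorMeasure
  singular : uC ⟂ᵥ (volume : Measure ℝ).toENNRealVectorMeasure
  diffuse : ∀ t, uC {t} = 0
  jump : uJ.restrict (essJumpSet T u) = uJ

/-- The reference measure `μ = L¹ + |u'_C|` on `(0, T)`. -/
noncomputable def refMeasure {X : Type*} [NormedAddCommGroup X]
    (T : ℝ) (uC : VectorMeasure ℝ X) : Measure ℝ :=
  volume.restrict (Ioo 0 T) + uC.variation

/-- `g` is a density of the vector measure `ν` with respect to `μ`: `dν/dμ = g`. -/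
def IsDensity {X : Type*} [NormedAddCommGroup X] [NormedSpace ℝ X]
    (ν : VectorMeasure ℝ X) (μ : Measure ℝ) (g : ℝ → X) : Prop :=
  Integrable g μ ∧ ∀ B, MeasurableSet B → ν B = ∫ t in B, g t ∂μ

/-! ### Local solutions, the BV differential inclusion and the jump inequalities -/

/-- Local solutions: local stability and the energy-dissipation inequality. -/
structure IsLocalSolution {X : Type*} [NormedAddCommGroup X] [NormedSpace ℝ X]
    (T : ℝ) (Ψ : X → ℝ) (E : ℝ → X → ℝ) (u : ℝ → X) : Prop where
  bv : BoundedVariationOn u (Icc 0 T)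
  stable : ∀ t ∈ Icc 0 T \ jumpSet T u, -stateDeriv E t (u t) ∈ stableSet Ψ
  energy : ∀ t₀ t₁, 0 ≤ t₀ → t₀ < t₁ → t₁ ≤ T →
    ((E t₁ (u t₁) : ℝ) : EReal) + (psiVar Ψ u t₀ t₁ : EReal) ≤
      ((E t₀ (u t₀) + ∫ t in t₀..t₁, timeDeriv T E t (u t) : ℝ) : EReal)

/-- The BV differential inclusion
`∂Ψ₀(du'_co/dμ(t)) + D E_t(u(t)) ∋ 0` for `μ`-a.e. `t`, where `u'_co = u'_L + u'_C` and
`μ = L¹ + |u'_C|`. The decomposition is unique, and so is the density up to `μ`-null sets. -/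
def BVInclusion {X : Type*} [NormedAddCommGroup X] [NormedSpace ℝ X] [FiniteDimensional ℝ X]
    {T : ℝ} (hT : 0 ≤ T) (Ψ : X → ℝ) (E : ℝ → X → ℝ) {u : ℝ → X}
    (hu : BoundedVariationOn u (Icc 0 T)) : Prop :=
  ∃ (uL uC uJ : VectorMeasure ℝ X) (g : ℝ → X),
    IsBVDecomposition hT hu uL uC uJ ∧ IsDensity (uL + uC) (refMeasure T uC) g ∧
    ∀ᵐ t ∂(refMeasure T uC), ∃ w ∈ subdifferential Ψ (g t), w + stateDeriv E t (u t) = 0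

/-- The dissipation cost `Δ_Ψ(v₀, v₁) = Ψ(v₁ - v₀)` of a jump. -/
def cost {X : Type*} [NormedAddCommGroup X] (Ψ : X → ℝ) (v₀ v₁ : X) : ℝ := Ψ (v₁ - v₀)

/-- The three jump inequalities at every jump time. -/
def JumpInequalities {X : Type*} [NormedAddCommGroup X] (T : ℝ) (Ψ : X → ℝ) (E : ℝ → X → ℝ)
    (u : ℝ → X) : Prop :=
  ∀ t ∈ jumpSet T u,
    E t (u t) - E t (left T u t) ≤ -cost Ψ (left T u t) (u t) ∧
    E t (right T u t) - E t (u t) ≤ -cost Ψ (u t) (right T u t) ∧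
    E t (right T u t) - E t (left T u t) ≤ -cost Ψ (left T u t) (right T u t)

end RIS

namespace RIS

/-! ### Gauges: stable set, subdifferential, variation -/

section Gauge

/-! A covector lies in `∂Ψ(v)` exactly when it lies in `K*` and satisfies `Ψ(v) ≤ ⟨w, v⟩`. The
inclusion thus splits into stability and the scalar inequality `Ψ(g) + DE_t(u)(g) ≤ 0`, with `g` the
density of `u'_co`, and the theorem splits likewise. Stability `μ`-a.e. and stability off the jump
set correspond by density, continuity and closedness of `K*`. The scalar inequality together with
the jump inequalities corresponds to the energy inequality, independently of stability.

The variation in the energy inequality may be replaced by the single increment `Ψ(u(b) - u(a))`,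
because the remaining terms telescope (`energy_inequality_iff`). One-sided limits of this form give
the jump inequalities. Blowing it up around a `μ`-typical point, where averages of `g` converge and
the jump part is negligible, gives the scalar inequality (`density_dissipation_le`).

Conversely, Hahn-Banach gives `w ∈ K*` with `w(u(b) - u(a)) = Ψ(u(b) - u(a))`, so it suffices that
`E_t(u(t)) + w(u(t)) - ∫ ∂ₜE` does not increase from `a` to `b`. No BV chain rule is invoked: near
any time, `DE` is frozen at a one-sided limit of `u`, the diffuse part and each jump contribute at
most a small multiple of their variation (`energy_le_on_cell`), and real induction chains the local
estimates (`forall_of_local`). The total error is `2η` times a finite measure, and `η → 0`. -/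

theorem le_psiVar {X : Type*} [NormedAddCommGroup X] (Ψ : X → ℝ) (u : ℝ → X) {a b : ℝ} (hab : a ≤ b) :
    ENNReal.ofReal (Ψ (u b - u a)) ≤ psiVar Ψ u a b := by
  refine le_iSup_of_le 1 (le_iSup_of_le (fun n => if n = 0 then a else b)
    (le_iSup_of_le ⟨?_, by simp, by simp⟩ (by simp)))
  intro m n hmn
  rcases Nat.eq_zero_or_pos m with rfl | hm
  · by_cases hn : n = 0 <;> simp [hn, hab]
  · simp [hm.ne', (hm.trans_le hmn).ne']

variable {X : Type*} [NormedAddCommGroup X] [NormedSpace ℝ X] {Ψ : X → ℝ}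

theorem IsGauge.map_zero (hΨ : IsGauge Ψ) : Ψ 0 = 0 := by
  simpa using hΨ.smul 0 0 le_rfl

theorem IsGauge.continuous [FiniteDimensional ℝ X] (hΨ : IsGauge Ψ) : Continuous Ψ := by
  have h : ConvexOn ℝ univ Ψ := by
    refine ⟨convex_univ, fun x _ y _ a b ha hb _ => ?_⟩
    refine (hΨ.add_le _ _).trans ?_
    rw [hΨ.smul a x ha, hΨ.smul b y hb]
    rfl
  exact continuousOn_univ.1 (h.continuousOn isOpen_univ)

/-- Hahn-Banach: `Ψ(v) = ⟨w, v⟩` for some `w ∈ K*`. -/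
theorem IsGauge.exists_mem_stableSet_apply_eq [FiniteDimensional ℝ X] (hΨ : IsGauge Ψ) (v : X) :
    ∃ w ∈ stableSet Ψ, w v = Ψ v := by
  by_cases hv : v = 0
  · exact ⟨0, fun z => by simpa using hΨ.nonneg z, by simp [hv, hΨ.map_zero]⟩
  let f : X →ₗ.[ℝ] ℝ := LinearPMap.mkSpanSingleton v (Ψ v) hv
  obtain ⟨w, hw, hle⟩ := exists_extension_of_le_sublinear f Ψ (fun c hc x => hΨ.smul c x hc.le)
    hΨ.add_le (by
      rintro ⟨x, hx⟩
      obtain ⟨c, rfl⟩ := Submodule.mem_span_singleton.1 hx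
      change (LinearPMap.mkSpanSingleton' v (Ψ v) _) ⟨c • v, hx⟩ ≤ Ψ (c • v)
      rw [LinearPMap.mkSpanSingleton'_apply, smul_eq_mul]
      -- `Ψ` need not be even: for `c ≤ 0` nonnegativity alone gives `c Ψ(v) ≤ 0 ≤ Ψ(c v)`.
      rcases le_total 0 c with hc | hc
      · exact (hΨ.smul c v hc).ge
      · exact (mul_nonpos_of_nonpos_of_nonneg hc (hΨ.nonneg v)).trans (hΨ.nonneg _))
  refine ⟨LinearMap.toContinuousLinearMap w, fun z => hle z, ?_⟩
  have := hw ⟨v, Submodule.mem_span_singleton_self v⟩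
  rw [LinearPMap.mkSpanSingleton_apply] at this
  exact this

theorem isClosed_stableSet : IsClosed (stableSet Ψ) := by
  simp only [stableSet, Set.ofPred_forall]
  exact isClosed_iInter fun z => isClosed_le (by fun_prop) continuous_const

/-- Testing at `v + z`: `Ψ(v) + w(z) ≤ Ψ(v + z) ≤ Ψ(v) + Ψ(z)`. -/
theorem IsGauge.mem_stableSet_of_mem_subdifferential (hΨ : IsGauge Ψ) {v : X}
    {w : StrongDual ℝ X} (hw : w ∈ subdifferential Ψ v) : w ∈ stableSet Ψ := fun z => by
  have h1 := hw (v + z)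
  have h2 := hΨ.add_le v z
  simp only [add_sub_cancel_left] at h1
  linarith

/-- Testing the subgradient inequality at `0` gives `Ψ(v) ≤ w(v)`. This separates the stability half
of the inclusion from its dissipation half. -/
theorem IsGauge.mem_subdifferential_iff (hΨ : IsGauge Ψ) {v : X} {w : StrongDual ℝ X} :
    w ∈ subdifferential Ψ v ↔ w ∈ stableSet Ψ ∧ Ψ v ≤ w v := by
  refine ⟨fun h => ⟨hΨ.mem_stableSet_of_mem_subdifferential h, ?_⟩, fun h z => ?_⟩
  · have := h 0
    rw [hΨ.map_zero] at this
    simp only [zero_sub, map_neg] at this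
    linarith
  · have := h.1 z
    rw [map_sub]
    linarith [h.2]

/-- An additive bound of the increments bounds the variation. -/
theorem psiVar_le_of_forall_le (u : ℝ → X) {a b : ℝ} (hΨ : IsGauge Ψ) {F : ℝ → ℝ}
    (h : ∀ s t, a ≤ s → s ≤ t → t ≤ b → Ψ (u t - u s) ≤ F s - F t) :
    psiVar Ψ u a b ≤ ENNReal.ofReal (F a - F b) := by
  refine iSup_le fun M => iSup_le fun t => iSup_le fun ⟨hm, h0, hM⟩ => ?_
  rw [← ENNReal.ofReal_sum_of_nonneg fun _ _ => hΨ.nonneg _]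
  refine ENNReal.ofReal_le_ofReal ?_
  rw [← h0, ← hM, ← Finset.sum_range_sub' (fun i => F (t i))]
  refine Finset.sum_le_sum fun i hi => h _ _ ?_ (hm (Nat.le_succ i)) ?_
  · rw [← h0]; exact hm (Nat.zero_le i)
  · rw [← hM]; exact hm (Finset.mem_range.1 hi)

end Gauge

/-! ### First-order expansion of the energy -/

section Energy

variable {X : Type*} [NormedAddCommGroup X] [NormedSpace ℝ X] {T : ℝ} {E : ℝ → X → ℝ}

theorem IsEnergy.hasFDerivWithinAt (hE : IsEnergy T E) {p : ℝ × X} (hp : p.1 ∈ Icc 0 T) :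
    HasFDerivWithinAt (fun p : ℝ × X => E p.1 p.2)
      (fderivWithin ℝ (fun p : ℝ × X => E p.1 p.2) (Icc 0 T ×ˢ univ) p) (Icc 0 T ×ˢ univ) p :=
  ((hE.contDiffOn.differentiableOn one_ne_zero) p ⟨hp, mem_univ _⟩).hasFDerivWithinAt

/-- Restricting to the slices `(r, x)` and `(t, y)` identifies the two partial derivatives; unique
differentiability on `[0, T]` makes this valid also at the end points. -/
theorem IsEnergy.fderivWithin_apply (hE : IsEnergy T E) (hT : 0 < T) {t : ℝ} (ht : t ∈ Icc 0 T)
    (x : X) (s : ℝ) (z : X) :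
    fderivWithin ℝ (fun p : ℝ × X => E p.1 p.2) (Icc 0 T ×ˢ univ) (t, x) (s, z) =
      timeDeriv T E t x * s + stateDeriv E t x z := by
  have h := hE.hasFDerivWithinAt (p := (t, x)) ht
  set D := fderivWithin ℝ (fun p : ℝ × X => E p.1 p.2) (Icc 0 T ×ˢ univ) (t, x)
  have h1 : HasDerivWithinAt (fun r => E r x) (D (1, 0)) (Icc 0 T) t := by
    have hg : HasDerivWithinAt (fun r : ℝ => (r, x)) ((1 : ℝ), (0 : X)) (Icc 0 T) t :=
      (hasDerivWithinAt_id t _).prodMk (hasDerivWithinAt_const t _ x)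
    exact HasFDerivWithinAt.comp_hasDerivWithinAt (t := Icc 0 T ×ˢ univ) t h hg
      fun r hr => ⟨hr, mem_univ _⟩
  have h2 : HasFDerivAt (E t) (D.comp (ContinuousLinearMap.inr ℝ ℝ X)) x := by
    have hg : HasFDerivWithinAt (fun y : X => (t, y)) (ContinuousLinearMap.inr ℝ ℝ X) univ x :=
      (hasFDerivAt_prodMk_right t x).hasFDerivWithinAt
    exact hasFDerivWithinAt_univ.1 (h.comp x hg fun y _ => ⟨ht, mem_univ _⟩)
  rw [timeDeriv, h1.derivWithin (uniqueDiffOn_Icc hT t ht), stateDeriv, h2.fderiv]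
  have : ((s, z) : ℝ × X) = s • ((1 : ℝ), (0 : X)) + ((0 : ℝ), z) := by simp
  rw [this, map_add, map_smul, smul_eq_mul, mul_comm]
  rfl

theorem IsEnergy.continuousOn_fderivWithin (hE : IsEnergy T E) (hT : 0 < T) :
    ContinuousOn (fderivWithin ℝ (fun p : ℝ × X => E p.1 p.2) (Icc 0 T ×ˢ univ))
      (Icc 0 T ×ˢ univ) :=
  hE.contDiffOn.continuousOn_fderivWithin ((uniqueDiffOn_Icc hT).prod uniqueDiffOn_univ) le_rfl

theorem IsEnergy.continuousOn_timeDeriv (hE : IsEnergy T E) (hT : 0 < T) :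
    ContinuousOn (fun p : ℝ × X => timeDeriv T E p.1 p.2) (Icc 0 T ×ˢ univ) := by
  refine ((hE.continuousOn_fderivWithin hT).clm_apply
    (continuousOn_const (c := ((1 : ℝ), (0 : X))))).congr fun p hp => ?_
  have := hE.fderivWithin_apply hT hp.1 p.2 1 0
  simp only [mul_one, map_zero, add_zero] at this
  exact this.symm

theorem IsEnergy.continuousOn_stateDeriv (hE : IsEnergy T E) (hT : 0 < T) :
    ContinuousOn (fun p : ℝ × X => stateDeriv E p.1 p.2) (Icc 0 T ×ˢ univ) := by
  refine ((hE.continuousOn_fderivWithin hT).clm_comp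
    (continuousOn_const (c := ContinuousLinearMap.inr ℝ ℝ X))).congr fun p hp => ?_
  ext z
  simp [hE.fderivWithin_apply hT hp.1]

theorem IsEnergy.continuousOn (hE : IsEnergy T E) :
    ContinuousOn (fun p : ℝ × X => E p.1 p.2) (Icc 0 T ×ˢ univ) :=
  hE.contDiffOn.continuousOn

/-- Uniform first-order expansion of the energy near a point. -/
theorem IsEnergy.exists_expansion (hE : IsEnergy T E) (hT : 0 < T) {t₀ : ℝ}
    (ht₀ : t₀ ∈ Icc 0 T) (x₀ : X) {η : ℝ} (hη : 0 < η) :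
    ∃ δ > 0,
      (∀ s ∈ Icc 0 T, ∀ x, dist s t₀ < δ → dist x x₀ < δ →
        |timeDeriv T E s x - timeDeriv T E t₀ x₀| ≤ η ∧
        ‖stateDeriv E s x - stateDeriv E t₀ x₀‖ ≤ η) ∧
      ∀ s ∈ Icc 0 T, ∀ s' ∈ Icc 0 T, ∀ x x', dist s t₀ < δ → dist s' t₀ < δ →
        dist x x₀ < δ → dist x' x₀ < δ →
        |E s' x' - E s x - timeDeriv T E t₀ x₀ * (s' - s) - stateDeriv E t₀ x₀ (x' - x)| ≤
          η * (|s' - s| + ‖x' - x‖) := by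
  have hmem : (t₀, x₀) ∈ Icc 0 T ×ˢ (univ : Set X) := ⟨ht₀, mem_univ _⟩
  obtain ⟨δ₁, h₁, H₁⟩ := Metric.continuousOn_iff.1 (hE.continuousOn_timeDeriv hT) _ hmem η hη
  obtain ⟨δ₂, h₂, H₂⟩ := Metric.continuousOn_iff.1 (hE.continuousOn_stateDeriv hT) _ hmem η hη
  obtain ⟨δ₃, h₃, H₃⟩ := Metric.continuousOn_iff.1 (hE.continuousOn_fderivWithin hT) _ hmem η hη
  have hd : ∀ {δ : ℝ} {s : ℝ} {x : X}, dist s t₀ < δ → dist x x₀ < δ →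
      dist (s, x) (t₀, x₀) < δ := fun h h' => max_lt h h'
  refine ⟨min δ₁ (min δ₂ δ₃), by positivity, fun s hs x hsd hxd => ⟨?_, ?_⟩, ?_⟩
  · exact (H₁ (s, x) ⟨hs, mem_univ _⟩ ((hd hsd hxd).trans_le (min_le_left _ _))).le
  · rw [← dist_eq_norm]
    exact (H₂ (s, x) ⟨hs, mem_univ _⟩ ((hd hsd hxd).trans_le
      ((min_le_right _ _).trans (min_le_left _ _)))).le
  · intro s hs s' hs' x x' h1 h2 h3 h4
    have hle : min δ₁ (min δ₂ δ₃) ≤ δ₃ := (min_le_right _ _).trans (min_le_right _ _)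
    have hconv : Convex ℝ ((Icc 0 T ×ˢ (univ : Set X)) ∩ Metric.ball (t₀, x₀) δ₃) :=
      ((convex_Icc _ _).prod convex_univ).inter (convex_ball _ _)
    -- Mean value inequality for `E` minus its frozen linearization, on a convex set where the
    -- derivative moves by at most `η`.
    have key := hconv.norm_image_sub_le_of_norm_hasFDerivWithin_le'
      (f := fun p : ℝ × X => E p.1 p.2) (x := (s, x)) (y := (s', x')) (C := η)
      (f' := fderivWithin ℝ (fun p : ℝ × X => E p.1 p.2) (Icc 0 T ×ˢ univ))
      (φ := fderivWithin ℝ (fun p : ℝ × X => E p.1 p.2) (Icc 0 T ×ˢ univ) (t₀, x₀))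
      (fun p hp => (hE.hasFDerivWithinAt hp.1.1).mono inter_subset_left)
      (fun p hp => by rw [← dist_eq_norm]; exact (H₃ p hp.1 hp.2).le)
      ⟨⟨hs, mem_univ _⟩, (hd h1 h3).trans_le hle⟩ ⟨⟨hs', mem_univ _⟩, (hd h2 h4).trans_le hle⟩
    rw [Prod.mk_sub_mk, hE.fderivWithin_apply hT ht₀, ← sub_sub] at key
    refine key.trans (mul_le_mul_of_nonneg_left ?_ hη.le)
    exact max_le (le_add_of_nonneg_right (norm_nonneg _)) (le_add_of_nonneg_left (abs_nonneg _))

/-- The expansion of the energy along a curve which stays near `x₀`. -/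
theorem IsEnergy.exists_expansion_integral (hE : IsEnergy T E) (hT : 0 < T) {t₀ : ℝ}
    (ht₀ : t₀ ∈ Icc 0 T) (x₀ : X) {η : ℝ} (hη : 0 < η) :
    ∃ δ > 0,
      (∀ s ∈ Icc 0 T, ∀ x, dist s t₀ < δ → dist x x₀ < δ →
        ‖stateDeriv E s x - stateDeriv E t₀ x₀‖ ≤ η) ∧
      ∀ s ∈ Icc 0 T, ∀ s' ∈ Icc 0 T, ∀ x x', s ≤ s' → dist s t₀ < δ → dist s' t₀ < δ →
        dist x x₀ < δ → dist x' x₀ < δ → ∀ v : ℝ → X, (∀ r ∈ Ioo s s', dist (v r) x₀ < δ) →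
        IntervalIntegrable (fun r => timeDeriv T E r (v r)) volume s s' →
        |E s' x' - E s x - (∫ r in s..s', timeDeriv T E r (v r)) - stateDeriv E t₀ x₀ (x' - x)| ≤
          η * ((s' - s) + ‖x' - x‖) := by
  -- One half of `η` pays for the expansion of `E`, the other for freezing `∂ₜE` along `v`.
  obtain ⟨δ, hδ, h1, h2⟩ := hE.exists_expansion hT ht₀ x₀ (half_pos hη)
  refine ⟨δ, hδ, fun s hs x hsd hxd => (h1 s hs x hsd hxd).2.trans (half_le_self hη.le), ?_⟩
  intro s hs s' hs' x x' hss hsd hsd' hx hx' v hv hint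
  have k1 := h2 s hs s' hs' x x' hsd hsd' hx hx'
  have k2 : |(∫ r in s..s', timeDeriv T E r (v r)) - timeDeriv T E t₀ x₀ * (s' - s)| ≤
      η / 2 * (s' - s) := by
    have e : timeDeriv T E t₀ x₀ * (s' - s) = ∫ _ in s..s', timeDeriv T E t₀ x₀ := by
      rw [intervalIntegral.integral_const, smul_eq_mul, mul_comm]
    rw [e, ← intervalIntegral.integral_sub hint intervalIntegrable_const]
    have := intervalIntegral.norm_integral_le_of_norm_le_const_ae (a := s) (b := s')
      (C := η / 2) (f := fun r => timeDeriv T E r (v r) - timeDeriv T E t₀ x₀) ?_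
    · rwa [abs_of_nonneg (sub_nonneg.2 hss)] at this
    -- The curve `v` is controlled only on the open interval, and `x`, `x'` are not tied to its end
    -- values, so that one-sided limits can be inserted for them. The end point is a null set.
    · have hne : ∀ᵐ r : ℝ, r ≠ s' := by simp [ae_iff]
      filter_upwards [hne] with r hr hr'
      rw [uIoc_of_le hss] at hr'
      refine (h1 r ⟨hs.1.trans hr'.1.le, hr'.2.trans hs'.2⟩ _ ?_
        (hv r ⟨hr'.1, lt_of_le_of_ne hr'.2 hr⟩)).1
      rw [Real.dist_eq, abs_lt] at *
      constructor <;> linarith [hr'.1, hr'.2]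
  rw [abs_of_nonneg (sub_nonneg.2 hss)] at k1
  have := norm_nonneg (x' - x)
  rw [abs_le] at *
  constructor <;> nlinarith [k1.1, k1.2, k2.1, k2.2]

end Energy


/-! ### One-sided limits and the jump set -/

section Limits

variable {X : Type*} {T : ℝ} {u : ℝ → X}

theorem extend_of_mem {t : ℝ} (ht : t ∈ Icc 0 T) :
    extend T u t = u t := by
  rw [extend, min_eq_left ht.2, max_eq_right ht.1]

variable [NormedAddCommGroup X]

theorem left_zero (hT : 0 < T) : left T u 0 = u 0 := by
  refine leftLim_eq_of_tendsto (tendsto_const_nhds.congr' ?_)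
  filter_upwards [self_mem_nhdsWithin] with s hs
  rw [extend, min_eq_left (hs.le.trans hT.le), max_eq_left hs.le]

theorem right_self (hT : 0 < T) : right T u T = u T := by
  refine rightLim_eq_of_tendsto (tendsto_const_nhds.congr' ?_)
  filter_upwards [self_mem_nhdsWithin] with s hs
  rw [extend, min_eq_right (le_of_lt hs), max_eq_right hT.le]

theorem left_eq_of_notMem {t : ℝ} (ht : t ∈ Icc 0 T \ jumpSet T u) : left T u t = u t := by
  by_contra h
  exact ht.2 ⟨ht.1, Or.inl h⟩

theorem right_eq_of_notMem {t : ℝ} (ht : t ∈ Icc 0 T \ jumpSet T u) : right T u t = u t := by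
  by_contra h
  exact ht.2 ⟨ht.1, Or.inr (Ne.symm h)⟩

theorem essJumpSet_subset_jumpSet : essJumpSet T u ⊆ jumpSet T u := by
  rintro t ⟨ht, h⟩
  refine ⟨ht, ?_⟩
  by_contra! hc
  exact h (hc.1.trans hc.2)

end Limits

/-! ### Curves of bounded variation and their derivative -/

section Curve

variable {X : Type*} [NormedAddCommGroup X] [NormedSpace ℝ X] [FiniteDimensional ℝ X]
  {T : ℝ} {u : ℝ → X}

theorem tendsto_extend_left (hT : 0 < T) (hu : BoundedVariationOn u (Icc 0 T)) (t : ℝ) :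
    Tendsto (extend T u) (𝓝[<] t) (𝓝 (left T u t)) := by
  have := FiniteDimensional.complete ℝ X
  exact (extend_bv hT.le hu).tendsto_leftLim t

theorem tendsto_extend_right (hT : 0 < T) (hu : BoundedVariationOn u (Icc 0 T)) (t : ℝ) :
    Tendsto (extend T u) (𝓝[>] t) (𝓝 (right T u t)) := by
  have := FiniteDimensional.complete ℝ X
  exact (extend_bv hT.le hu).tendsto_rightLim t

theorem tendsto_left (hT : 0 < T) (hu : BoundedVariationOn u (Icc 0 T)) {t : ℝ}
    (ht : t ∈ Ioc 0 T) : Tendsto u (𝓝[<] t) (𝓝 (left T u t)) := by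
  refine (tendsto_extend_left hT hu t).congr' ?_
  filter_upwards [Ioo_mem_nhdsLT ht.1] with s hs
  exact extend_of_mem ⟨hs.1.le, hs.2.le.trans ht.2⟩

theorem tendsto_right (hT : 0 < T) (hu : BoundedVariationOn u (Icc 0 T)) {t : ℝ}
    (ht : t ∈ Ico 0 T) : Tendsto u (𝓝[>] t) (𝓝 (right T u t)) := by
  refine (tendsto_extend_right hT hu t).congr' ?_
  filter_upwards [Ioo_mem_nhdsGT ht.2] with s hs
  exact extend_of_mem ⟨ht.1.trans hs.1.le, hs.2.le⟩

theorem continuousAt_extend (hT : 0 < T) (hu : BoundedVariationOn u (Icc 0 T)) {t : ℝ}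
    (ht : t ∈ Icc 0 T \ jumpSet T u) : ContinuousAt (extend T u) t := by
  rw [continuousAt_iff_continuous_left'_right']
  have h1 := tendsto_extend_left hT hu t
  have h2 := tendsto_extend_right hT hu t
  rw [left_eq_of_notMem ht, ← extend_of_mem (u := u) ht.1] at h1
  rw [right_eq_of_notMem ht, ← extend_of_mem (u := u) ht.1] at h2
  exact ⟨h1, h2⟩

theorem continuousWithinAt_of_notMem_jumpSet (hT : 0 < T) (hu : BoundedVariationOn u (Icc 0 T))
    {t : ℝ} (ht : t ∈ Icc 0 T \ jumpSet T u) : ContinuousWithinAt u (Icc 0 T) t :=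
  (continuousAt_extend hT hu ht).continuousWithinAt.congr
    (fun _ hs => (extend_of_mem hs).symm) (extend_of_mem ht.1).symm

/-- At a jump of `u` its variation function jumps by the same size, and a monotone function has
countably many discontinuities. -/
theorem countable_jumpSet (hT : 0 < T) (hu : BoundedVariationOn u (Icc 0 T)) :
    (jumpSet T u).Countable := by
  have := FiniteDimensional.complete ℝ X
  have hbv := extend_bv hT.le hu
  set V := variationOnFromTo (extend T u) univ 0
  have hV : Monotone V := monotoneOn_univ.1
    (variationOnFromTo.monotoneOn hbv.locallyBoundedVariationOn (mem_univ 0))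
  refine hV.countable_not_continuousAt.mono ?_
  intro t ht
  rw [mem_ofPred_eq]
  intro hc
  have h1 := variationOnFromTo.leftLim_eq (a := 0) (b := t) hbv
  have h2 := variationOnFromTo.rightLim_eq (a := 0) (b := t) hbv
  change V.leftLim t = V t - _ at h1
  change V.rightLim t = V t + _ at h2
  rw [hc.continuousWithinAt.leftLim_eq] at h1
  rw [hc.continuousWithinAt.rightLim_eq] at h2
  rcases ht.2 with h | h
  · refine h (dist_eq_zero.1 ?_)
    rw [dist_comm, ← extend_of_mem (u := u) ht.1]
    unfold left
    linarith
  · refine h (dist_eq_zero.1 ?_)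
    rw [← extend_of_mem (u := u) ht.1]
    unfold right
    linarith

/-- Off the countable jump set the integrand is continuous, hence measurable. It is bounded because
`u` stays in a ball around `u 0` of radius its variation, which is compact in finite dimension. -/
theorem intervalIntegrable_timeDeriv {E : ℝ → X → ℝ} (hE : IsEnergy T E) (hT : 0 < T)
    (hu : BoundedVariationOn u (Icc 0 T)) {a b : ℝ} (ha : a ∈ Icc 0 T) (hb : b ∈ Icc 0 T) :
    IntervalIntegrable (fun r => timeDeriv T E r (u r)) volume a b := by
  have hsub : uIcc a b ⊆ Icc 0 T := (ordConnected_Icc).uIcc_subset ha hb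
  rw [intervalIntegrable_iff]
  refine IntegrableOn.mono_set (t := Icc 0 T) ?_ (uIoc_subset_uIcc.trans hsub)
  have hJ := countable_jumpSet hT hu
  have hcont : ContinuousOn (fun r => timeDeriv T E r (u r)) (Icc 0 T \ jumpSet T u) := by
    intro t ht
    have h1 : ContinuousWithinAt (fun r => (r, u r)) (Icc 0 T) t :=
      continuousWithinAt_id.prodMk (continuousWithinAt_of_notMem_jumpSet hT hu ht)
    exact ((hE.continuousOn_timeDeriv hT (t, u t) ⟨ht.1, mem_univ _⟩).comp_of_eq h1
      (fun r hr => ⟨hr, mem_univ _⟩) rfl).mono sdiff_subset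
  have hmeas : AEStronglyMeasurable (fun r => timeDeriv T E r (u r))
      (volume.restrict (Icc 0 T)) := by
    have h := hcont.aestronglyMeasurable (μ := volume) (measurableSet_Icc.diff hJ.measurableSet)
    rwa [Measure.restrict_congr_set (sdiff_null_ae_eq_self (hJ.measure_zero volume))] at h
  obtain ⟨C, hC⟩ := ((isCompact_Icc (a := (0 : ℝ)) (b := T)).prod
    (isCompact_closedBall (u 0) (eVariationOn u (Icc 0 T)).toReal)).exists_bound_of_continuousOn
    ((hE.continuousOn_timeDeriv hT).mono (prod_mono le_rfl (subset_univ _)))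
  refine Integrable.of_bound hmeas C ?_
  filter_upwards [ae_restrict_mem measurableSet_Icc] with r hr
  exact hC (r, u r) ⟨hr, hu.dist_le hr ⟨le_rfl, hT.le⟩⟩

/-- An open interval may reach `0` or `T`; the closed intervals of `bvDeriv_Icc` may not, since
jumps at `0` and `T` are not part of `u'`. -/
theorem bvDeriv_Ioo (hT : 0 < T) (hu : BoundedVariationOn u (Icc 0 T)) {a b : ℝ} (ha : 0 ≤ a)
    (hab : a < b) (hb : b ≤ T) :
    bvDeriv hT.le hu (Ioo a b) = left T u b - right T u a := by
  rw [bvDeriv, VectorMeasure.restrict_eq_self _ measurableSet_Ioo measurableSet_Ioo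
    (Ioo_subset_Ioo ha hb), BoundedVariationOn.vectorMeasure_Ioo _ hab]
  rfl

theorem bvDeriv_Icc (hT : 0 < T) (hu : BoundedVariationOn u (Icc 0 T)) {a b : ℝ} (ha : 0 < a)
    (hab : a ≤ b) (hb : b < T) :
    bvDeriv hT.le hu (Icc a b) = right T u b - left T u a := by
  rw [bvDeriv, VectorMeasure.restrict_eq_self _ measurableSet_Ioo measurableSet_Icc
    (Icc_subset_Ioo ha hb), BoundedVariationOn.vectorMeasure_Icc _ hab]
  rfl

theorem bvDeriv_singleton (hT : 0 < T) (hu : BoundedVariationOn u (Icc 0 T)) {t : ℝ}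
    (ht : t ∈ Ioo 0 T) : bvDeriv hT.le hu {t} = right T u t - left T u t := by
  rw [← Icc_self, bvDeriv_Icc hT hu ht.1 le_rfl ht.2]

theorem measurableSet_essJumpSet (hT : 0 < T) (hu : BoundedVariationOn u (Icc 0 T)) :
    MeasurableSet (essJumpSet T u) :=
  ((countable_jumpSet hT hu).mono essJumpSet_subset_jumpSet).measurableSet

/-- A value `u(t)` differing from `u(t₋) = u(t₊)` leaves no trace in `u'`. -/
theorem bvDeriv_singleton_eq_zero (hT : 0 < T) (hu : BoundedVariationOn u (Icc 0 T)) {t : ℝ}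
    (ht : t ∉ essJumpSet T u) : bvDeriv hT.le hu {t} = 0 := by
  by_cases h : t ∈ Ioo 0 T
  · rw [bvDeriv_singleton hT hu h, sub_eq_zero]
    by_contra hne
    exact ht ⟨Ioo_subset_Icc_self h, Ne.symm hne⟩
  · rw [bvDeriv, VectorMeasure.restrict_apply _ measurableSet_Ioo (measurableSet_singleton t),
      singleton_inter_eq_empty.2 h, VectorMeasure.empty]

end Curve


/-! ### The reference measure and vector densities -/

section Density

variable {X : Type*} [NormedAddCommGroup X]

theorem refMeasure_singleton (T : ℝ) {uC : VectorMeasure ℝ X} (h : ∀ t, uC {t} = 0) (t : ℝ) :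
    refMeasure T uC {t} = 0 := by
  have h1 : uC.variation {t} = 0 := by
    rw [VectorMeasure.variation_apply_eq_zero (measurableSet_singleton t)]
    intro s hs _
    rcases subset_singleton_iff_eq.1 hs with rfl | rfl
    · exact uC.empty
    · exact h t
  have h2 : volume.restrict (Ioo 0 T) {t} = 0 :=
    le_antisymm ((Measure.restrict_apply_le _ _).trans (by simp)) (zero_le)
  rw [refMeasure, Measure.add_apply, h1, h2, add_zero]

variable [NormedSpace ℝ X] [FiniteDimensional ℝ X]

theorem isFiniteMeasure_refMeasure (T : ℝ) (uC : VectorMeasure ℝ X) :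
    IsFiniteMeasure (refMeasure T uC) := by
  have := isFiniteMeasure_variation uC
  rw [refMeasure]
  infer_instance

/-- The Radon-Nikodym theorem for vector measures in finite dimension. -/
theorem exists_isDensity (ν : VectorMeasure ℝ X) (μ : Measure ℝ) [IsFiniteMeasure μ]
    (h : ∀ A, MeasurableSet A → μ A = 0 → ν A = 0) : ∃ g, IsDensity ν μ g := by
  have := FiniteDimensional.complete ℝ X
  let b := Module.finBasis ℝ X
  let c : Fin (Module.finrank ℝ X) → X →L[ℝ] ℝ := fun i => (b.coord i).toContinuousLinearMap
  let σ : Fin (Module.finrank ℝ X) → SignedMeasure ℝ := fun i =>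
    ν.mapRange (c i).toLinearMap.toAddMonoidHom (c i).continuous
  have hσ : ∀ i B, σ i B = b.coord i (ν B) := fun i B => rfl
  have hac : ∀ i, μ.withDensityᵥ ((σ i).rnDeriv μ) = σ i := fun i => by
    refine SignedMeasure.withDensityᵥ_rnDeriv_eq _ _ (VectorMeasure.AbsolutelyContinuous.mk ?_)
    intro s hs h0
    rw [Measure.toENNRealVectorMeasure_apply_measurable hs] at h0
    rw [hσ, h s hs h0, map_zero]
  have hint : ∀ i, Integrable ((σ i).rnDeriv μ) μ := fun i => SignedMeasure.integrable_rnDeriv _ _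
  refine ⟨fun t => ∑ i, (σ i).rnDeriv μ t • b i,
    integrable_finsetSum _ fun i _ => (hint i).smul_const _, fun B hB => ?_⟩
  rw [integral_finsetSum _ fun i _ => ((hint i).smul_const _).integrableOn]
  simp_rw [integral_smul_const]
  conv_lhs => rw [← b.sum_repr (ν B)]
  refine Finset.sum_congr rfl fun i _ => ?_
  rw [← withDensityᵥ_apply (hint i) hB, hac i, hσ]
  rfl

end Density

/-! ### Absolutely continuous, Cantor and jump parts -/

section Decomposition

variable {X : Type*} [NormedAddCommGroup X] [NormedSpace ℝ X] [FiniteDimensional ℝ X]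
  {T : ℝ} {u : ℝ → X}

/-- The derivative of a curve of bounded variation decomposes, and its diffuse part has a density
with respect to the reference measure. -/
theorem exists_isBVDecomposition (hT : 0 < T) (hu : BoundedVariationOn u (Icc 0 T)) :
    ∃ (uL uC uJ : VectorMeasure ℝ X) (g : ℝ → X),
      IsBVDecomposition hT.le hu uL uC uJ ∧ IsDensity (uL + uC) (refMeasure T uC) g ∧
      refMeasure T uC (Ioo 0 T)ᶜ = 0 := by
  set ν := bvDeriv hT.le hu with hν
  set S := essJumpSet T u
  have hS : MeasurableSet S := measurableSet_essJumpSet hT hu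
  set d := ν.restrict Sᶜ with hd
  have hfin := isFiniteMeasure_variation d
  -- The singular part of `|d|` vanishes on `s`, while `sᶜ` is Lebesgue-null: restricting the
  -- diffuse part `d` to `s` and `sᶜ` separates its absolutely continuous and Cantor parts.
  obtain ⟨s, hs, hs1, hs2⟩ := Measure.mutuallySingular_singularPart d.variation volume
  set uL := d.restrict s with huL
  set uC := d.restrict sᶜ with huC
  have hL : ∀ A, MeasurableSet A → volume A = 0 → uL A = 0 := by
    intro A hA hA0
    rw [huL, VectorMeasure.restrict_apply _ hs hA, ← enorm_eq_zero, ← nonpos_iff_eq_zero]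
    refine (VectorMeasure.enorm_measure_le_variation d _).trans ?_
    rw [Measure.haveLebesgueDecomposition_add d.variation volume, Measure.add_apply,
      measure_mono_null inter_subset_right hs1, zero_add]
    exact (withDensity_absolutelyContinuous _ _ (measure_mono_null inter_subset_left hA0)).le
  have hdat : ∀ t, d {t} = 0 := fun t => by
    rw [hd, VectorMeasure.restrict_apply _ hS.compl (measurableSet_singleton t)]
    by_cases ht : t ∈ S
    · rw [singleton_inter_eq_empty.2 (by simpa using ht), VectorMeasure.empty]
    · rw [inter_eq_left.2 (by simpa using ht)]
      exact bvDeriv_singleton_eq_zero hT hu ht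
  have hCat : ∀ t, uC {t} = 0 := fun t => by
    rw [huC, VectorMeasure.restrict_apply _ hs.compl (measurableSet_singleton t)]
    rcases subset_singleton_iff_eq.1 (inter_subset_left (s := {t}) (t := sᶜ)) with h | h
    · rw [h, VectorMeasure.empty]
    · rw [h, hdat]
  have hdec : IsBVDecomposition hT.le hu uL uC (ν.restrict S) := by
    refine ⟨?_, ?_, ?_, hCat, ?_⟩
    · rw [huL, huC, VectorMeasure.restrict_add_restrict_compl hs, hd, add_comm,
        VectorMeasure.restrict_add_restrict_compl hS]
    · refine VectorMeasure.AbsolutelyContinuous.mk fun A hA h0 => hL A hA ?_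
      rwa [Measure.toENNRealVectorMeasure_apply_measurable hA] at h0
    · refine VectorMeasure.MutuallySingular.mk s hs (fun A hA hAm => ?_) fun A hA hAm => ?_
      · rw [huC, VectorMeasure.restrict_apply _ hs.compl hAm,
          disjoint_iff_inter_eq_empty.1 (disjoint_compl_right.mono_left hA), VectorMeasure.empty]
      · rw [Measure.toENNRealVectorMeasure_apply_measurable hAm]
        exact measure_mono_null hA hs2
    · rw [VectorMeasure.restrict_restrict _ hS hS, inter_self]
  have hfin' := isFiniteMeasure_refMeasure T uC
  have hac : ∀ A, MeasurableSet A → refMeasure T uC A = 0 → (uL + uC) A = 0 := by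
    intro A hA h0
    rw [refMeasure, Measure.add_apply, add_eq_zero] at h0
    have h1 : uC A = 0 := by
      rw [← enorm_eq_zero, ← nonpos_iff_eq_zero]
      exact (VectorMeasure.enorm_measure_le_variation _ _).trans h0.2.le
    -- The Lebesgue part of `refMeasure` sees only `A ∩ (0, T)`, so `uL` must not charge the
    -- complement of `(0, T)`.
    have h2 : uL A = uL (A ∩ Ioo 0 T) := by
      have hI := measurableSet_Ioo (a := (0 : ℝ)) (b := T)
      have e : ∀ B, MeasurableSet B →
          uL B = (extend_bv hT.le hu).vectorMeasure (((B ∩ s) ∩ Sᶜ) ∩ Ioo 0 T) := fun B hB => by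
        rw [huL, VectorMeasure.restrict_apply _ hs hB, hd,
          VectorMeasure.restrict_apply _ hS.compl (hB.inter hs), hν, bvDeriv,
          VectorMeasure.restrict_apply _ hI ((hB.inter hs).inter hS.compl)]
      rw [e A hA, e _ (hA.inter hI)]
      congr 1
      ext x
      simp only [mem_inter_iff]
      tauto
    rw [Measure.restrict_apply hA] at h0
    rw [_root_.add_apply, h1, h2, hL _ (hA.inter measurableSet_Ioo) h0.1, add_zero]
  obtain ⟨g, hg⟩ := exists_isDensity (uL + uC) (refMeasure T uC) hac
  refine ⟨uL, uC, _, g, hdec, hg, ?_⟩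
  have h0 : volume.restrict (Ioo 0 T) (Ioo 0 T)ᶜ = 0 := by
    rw [Measure.restrict_apply measurableSet_Ioo.compl, compl_inter_self, measure_empty]
  rw [refMeasure, Measure.add_apply, h0, zero_add,
    VectorMeasure.variation_apply_eq_zero measurableSet_Ioo.compl]
  intro A hA hAm
  rw [huC, VectorMeasure.restrict_apply _ hs.compl hAm, hd,
    VectorMeasure.restrict_apply _ hS.compl (hAm.inter hs.compl), hν, bvDeriv,
    VectorMeasure.restrict_apply _ measurableSet_Ioo ((hAm.inter hs.compl).inter hS.compl),
    disjoint_iff_inter_eq_empty.1, VectorMeasure.empty]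
  exact disjoint_compl_left.mono_left
    ((inter_subset_left.trans inter_subset_left).trans hA)

variable {hT : 0 ≤ T} {hu : BoundedVariationOn u (Icc 0 T)} {uL uC uJ : VectorMeasure ℝ X}

theorem IsBVDecomposition.jump_apply (h : IsBVDecomposition hT hu uL uC uJ)
    (hS : MeasurableSet (essJumpSet T u)) {A : Set ℝ} (hA : MeasurableSet A) :
    uJ A = uJ (A ∩ essJumpSet T u) := by
  conv_lhs => rw [← h.jump]
  rw [VectorMeasure.restrict_apply _ hS hA]

theorem IsBVDecomposition.jump_singleton (h : IsBVDecomposition hT hu uL uC uJ) (t : ℝ) :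
    uJ {t} = bvDeriv hT hu {t} := by
  have hL : uL {t} = 0 := h.ac (by
    rw [Measure.toENNRealVectorMeasure_apply_measurable (measurableSet_singleton t)]
    simp)
  rw [h.sum_eq, _root_.add_apply, _root_.add_apply, hL, h.diffuse]
  simp

theorem IsBVDecomposition.refMeasure_jumpSet (h : IsBVDecomposition hT hu uL uC uJ)
    (hT' : 0 < T) : refMeasure T uC (jumpSet T u) = 0 := by
  have : NullSingletonClass (refMeasure T uC) := ⟨refMeasure_singleton T h.diffuse⟩
  exact (countable_jumpSet hT' hu).measure_zero _

/-- The jump part is negligible with respect to the reference measure at small scales. -/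
theorem IsBVDecomposition.ae_tendsto_jump (h : IsBVDecomposition hT hu uL uC uJ) (hT' : 0 < T) :
    ∀ᵐ t ∂(refMeasure T uC), Tendsto (fun r => uJ.variation (Metric.closedBall t r) /
      refMeasure T uC (Metric.closedBall t r)) (𝓝[>] 0) (𝓝 0) := by
  have hf1 := isFiniteMeasure_refMeasure T uC
  have hf2 := isFiniteMeasure_variation uJ
  have hS := measurableSet_essJumpSet hT' hu
  -- `uJ` lives on a countable set, which the atomless reference measure does not charge.
  -- Besicovitch differentiation of `|uJ|` therefore has limit zero almost everywhere.
  have hsing : uJ.variation ⟂ₘ refMeasure T uC := by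
    refine ⟨(essJumpSet T u)ᶜ, hS.compl, ?_, ?_⟩
    · rw [VectorMeasure.variation_apply_eq_zero hS.compl]
      intro A hA hAm
      rw [h.jump_apply hS hAm, disjoint_iff_inter_eq_empty.1 (disjoint_compl_left.mono_left hA),
        VectorMeasure.empty]
    · rw [compl_compl]
      exact measure_mono_null essJumpSet_subset_jumpSet (h.refMeasure_jumpSet hT')
  filter_upwards [Besicovitch.ae_tendsto_rnDeriv uJ.variation (refMeasure T uC),
    (Measure.rnDeriv_eq_zero _ _).2 hsing] with t h1 h2
  rwa [h2] at h1

end Decomposition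


/-! ### The increment form of the energy inequality and its one-sided limits -/

section Energy

variable {X : Type*} [NormedAddCommGroup X] [NormedSpace ℝ X] [FiniteDimensional ℝ X]
  {T : ℝ} {u : ℝ → X} {E : ℝ → X → ℝ} {Ψ : X → ℝ}

theorem integral_timeDeriv_sub (hE : IsEnergy T E) (hT : 0 < T)
    (hu : BoundedVariationOn u (Icc 0 T)) {a b : ℝ} (ha : a ∈ Icc 0 T) (hb : b ∈ Icc 0 T) :
    (∫ r in 0..b, timeDeriv T E r (u r)) - ∫ r in 0..a, timeDeriv T E r (u r) =
      ∫ r in a..b, timeDeriv T E r (u r) :=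
  have h0 : (0 : ℝ) ∈ Icc 0 T := ⟨le_rfl, hT.le⟩
  intervalIntegral.integral_interval_sub_left (intervalIntegrable_timeDeriv hE hT hu h0 hb)
    (intervalIntegrable_timeDeriv hE hT hu h0 ha)

/-- The energy-dissipation inequality, written with increments instead of variations. -/
theorem energy_inequality_iff (hΨ : IsGauge Ψ) (hE : IsEnergy T E) (hT : 0 < T)
    (hu : BoundedVariationOn u (Icc 0 T)) :
    (∀ t₀ t₁, 0 ≤ t₀ → t₀ < t₁ → t₁ ≤ T →
      ((E t₁ (u t₁) : ℝ) : EReal) + (psiVar Ψ u t₀ t₁ : EReal) ≤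
        ((E t₀ (u t₀) + ∫ t in t₀..t₁, timeDeriv T E t (u t) : ℝ) : EReal)) ↔
    ∀ a b, 0 ≤ a → a ≤ b → b ≤ T →
      E b (u b) + Ψ (u b - u a) ≤ E a (u a) + ∫ t in a..b, timeDeriv T E t (u t) := by
  constructor
  · intro h a b ha hab hb
    rcases hab.eq_or_lt with rfl | hab'
    · simp [hΨ.map_zero]
    have h1 := h a b ha hab' hb
    have h2 : ((Ψ (u b - u a) : ℝ) : EReal) ≤ (psiVar Ψ u a b : EReal) := by
      rw [← max_eq_left (hΨ.nonneg (u b - u a)), ← EReal.coe_ennreal_ofReal]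
      exact EReal.coe_ennreal_le_coe_ennreal_iff.2 (le_psiVar Ψ u hab)
    have h3 := (add_le_add_right h2 ((E b (u b) : ℝ) : EReal)).trans h1
    exact_mod_cast h3
  · intro h a b ha hab hb
    -- With `F(s) = E_s(u(s)) - ∫₀ˢ ∂ₜE`, the hypothesis reads `Ψ(u(t) - u(s)) ≤ F(s) - F(t)`, which
    -- telescopes over every partition.
    have key := psiVar_le_of_forall_le (a := a) (b := b) u hΨ
      (F := fun s => E s (u s) - ∫ r in 0..s, timeDeriv T E r (u r)) fun s t hs hst ht => by
        have h1 := h s t (ha.trans hs) hst (ht.trans hb)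
        rw [← integral_timeDeriv_sub hE hT hu ⟨ha.trans hs, hst.trans (ht.trans hb)⟩
          ⟨(ha.trans hs).trans hst, ht.trans hb⟩] at h1
        linarith
    have h1 := h a b ha hab.le hb
    have e := integral_timeDeriv_sub hE hT hu ⟨ha, hab.le.trans hb⟩ ⟨ha.trans hab.le, hb⟩
    set F := (E a (u a) - ∫ r in 0..a, timeDeriv T E r (u r)) -
      (E b (u b) - ∫ r in 0..b, timeDeriv T E r (u r)) with hF
    have hF0 : 0 ≤ F := by
      have := hΨ.nonneg (u b - u a)
      rw [← e] at h1
      linarith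
    have h2 : (psiVar Ψ u a b : EReal) ≤ ((F : ℝ) : EReal) := by
      refine (EReal.coe_ennreal_le_coe_ennreal_iff.2 key).trans_eq ?_
      rw [EReal.coe_ennreal_ofReal, max_eq_left hF0]
    refine (add_le_add_right h2 _).trans ?_
    rw [← EReal.coe_add, EReal.coe_le_coe_iff, ← e]
    linarith

theorem tendsto_energy_left (hE : IsEnergy T E) (hT : 0 < T)
    (hu : BoundedVariationOn u (Icc 0 T)) {t : ℝ} (ht : t ∈ Ioc 0 T) :
    Tendsto (fun s => E s (u s)) (𝓝[<] t) (𝓝 (E t (left T u t))) := by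
  have h1 : Tendsto (fun s => (s, u s)) (𝓝[<] t)
      (𝓝[Icc 0 T ×ˢ univ] (t, left T u t)) := by
    refine tendsto_nhdsWithin_iff.2 ⟨?_, ?_⟩
    · exact (tendsto_nhdsWithin_of_tendsto_nhds tendsto_id).prodMk_nhds (tendsto_left hT hu ht)
    · filter_upwards [Ioo_mem_nhdsLT ht.1] with s hs
      exact ⟨⟨hs.1.le, hs.2.le.trans ht.2⟩, mem_univ _⟩
  exact (hE.continuousOn (t, left T u t) ⟨Ioc_subset_Icc_self ht, mem_univ _⟩).tendsto.comp h1

theorem tendsto_energy_right (hE : IsEnergy T E) (hT : 0 < T)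
    (hu : BoundedVariationOn u (Icc 0 T)) {t : ℝ} (ht : t ∈ Ico 0 T) :
    Tendsto (fun s => E s (u s)) (𝓝[>] t) (𝓝 (E t (right T u t))) := by
  have h1 : Tendsto (fun s => (s, u s)) (𝓝[>] t)
      (𝓝[Icc 0 T ×ˢ univ] (t, right T u t)) := by
    refine tendsto_nhdsWithin_iff.2 ⟨?_, ?_⟩
    · exact (tendsto_nhdsWithin_of_tendsto_nhds tendsto_id).prodMk_nhds (tendsto_right hT hu ht)
    · filter_upwards [Ioo_mem_nhdsGT ht.2] with s hs
      exact ⟨⟨ht.1.trans hs.1.le, hs.2.le⟩, mem_univ _⟩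
  exact (hE.continuousOn (t, right T u t) ⟨Ico_subset_Icc_self ht, mem_univ _⟩).tendsto.comp h1

theorem tendsto_integral_timeDeriv (hE : IsEnergy T E) (hT : 0 < T)
    (hu : BoundedVariationOn u (Icc 0 T)) {t : ℝ} (ht : t ∈ Icc 0 T) :
    Tendsto (fun s => ∫ r in s..t, timeDeriv T E r (u r)) (𝓝[Icc 0 T] t) (𝓝 0) := by
  have h0 : (0 : ℝ) ∈ Icc 0 T := ⟨le_rfl, hT.le⟩
  have h1 := intervalIntegral.continuousOn_primitive_interval' (a := 0)
    (intervalIntegrable_timeDeriv hE hT hu h0 ⟨hT.le, le_rfl⟩) (by simp [hT.le])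
  rw [uIcc_of_le hT.le] at h1
  have h2 := (tendsto_const_nhds (x := ∫ r in 0..t, timeDeriv T E r (u r))).sub (h1 t ht).tendsto
  rw [sub_self] at h2
  refine h2.congr' ?_
  filter_upwards [self_mem_nhdsWithin] with s hs
  exact integral_timeDeriv_sub hE hT hu hs ht

variable (hΨ : IsGauge Ψ) (hE : IsEnergy T E) (hT : 0 < T) (hu : BoundedVariationOn u (Icc 0 T))
  (h : ∀ a b, 0 ≤ a → a ≤ b → b ≤ T →
    E b (u b) + Ψ (u b - u a) ≤ E a (u a) + ∫ t in a..b, timeDeriv T E t (u t))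
include hΨ hE hT hu h

/-- The limit `s ↑ t` of the inequality on `[s, t]`, whose integral vanishes. At `t = 0` the
convention `u(0₋) = u(0)` makes it trivial. -/
theorem left_jump_le {t : ℝ} (ht : t ∈ Icc 0 T) :
    E t (u t) + Ψ (u t - left T u t) ≤ E t (left T u t) := by
  rcases ht.1.eq_or_lt with rfl | h0
  · simp [left_zero hT, hΨ.map_zero]
  have hI : Tendsto (fun s => ∫ r in s..t, timeDeriv T E r (u r)) (𝓝[<] t) (𝓝 0) :=
    (tendsto_integral_timeDeriv hE hT hu ht).mono_left (nhdsWithin_le_of_mem (by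
      filter_upwards [Ioo_mem_nhdsLT h0] with s hs using ⟨hs.1.le, hs.2.le.trans ht.2⟩))
  have h1 := ((hΨ.continuous.tendsto _).comp
    ((tendsto_left hT hu ⟨h0, ht.2⟩).const_sub (u t))).const_add (E t (u t))
  have h2 := (tendsto_energy_left hE hT hu ⟨h0, ht.2⟩).add hI
  rw [add_zero] at h2
  refine le_of_tendsto_of_tendsto h1 h2 ?_
  filter_upwards [Ioo_mem_nhdsLT h0] with s hs
  exact h s t hs.1.le hs.2.le ht.2

theorem right_jump_le {t : ℝ} (ht : t ∈ Icc 0 T) :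
    E t (right T u t) + Ψ (right T u t - u t) ≤ E t (u t) := by
  rcases ht.2.eq_or_lt with rfl | h0
  · simp [right_self hT, hΨ.map_zero]
  have hI : Tendsto (fun s => ∫ r in s..t, timeDeriv T E r (u r)) (𝓝[>] t) (𝓝 0) :=
    (tendsto_integral_timeDeriv hE hT hu ht).mono_left (nhdsWithin_le_of_mem (by
      filter_upwards [Ioo_mem_nhdsGT h0] with s hs using ⟨ht.1.trans hs.1.le, hs.2.le⟩))
  have h1 := (tendsto_energy_right hE hT hu ⟨ht.1, h0⟩).add ((hΨ.continuous.tendsto _).comp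
    ((tendsto_right hT hu ⟨ht.1, h0⟩).sub_const (u t)))
  have h2 := hI.const_sub (E t (u t))
  rw [sub_zero] at h2
  refine le_of_tendsto_of_tendsto h1 h2 ?_
  filter_upwards [Ioo_mem_nhdsGT h0] with s hs
  rw [intervalIntegral.integral_symm, sub_neg_eq_add]
  exact h t s ht.1 hs.1.le hs.2.le

/-- The jump at `a`, the inequality on `[a, b]` and the jump at `b` add up by subadditivity. These
are the limits that match `u'([a, b]) = u(b₊) - u(a₋)`; the case `a = b` is the third jump
inequality. -/
theorem one_sided_limits_le {a b : ℝ} (ha : 0 ≤ a) (hab : a ≤ b) (hb : b ≤ T) :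
    E b (right T u b) + Ψ (right T u b - left T u a) ≤
      E a (left T u a) + ∫ t in a..b, timeDeriv T E t (u t) := by
  have h1 := left_jump_le hΨ hE hT hu h ⟨ha, hab.trans hb⟩
  have h2 := h a b ha hab hb
  have h3 := right_jump_le hΨ hE hT hu h ⟨ha.trans hab, hb⟩
  have h4 := hΨ.add_le (right T u b - u b) (u b - u a)
  have h5 := hΨ.add_le (right T u b - u a) (u a - left T u a)
  rw [sub_add_sub_cancel] at h4 h5
  linarith

theorem jumpInequalities_of_energy : JumpInequalities T Ψ E u := by
  intro t ht
  have h1 := left_jump_le hΨ hE hT hu h ht.1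
  have h2 := right_jump_le hΨ hE hT hu h ht.1
  have h3 := one_sided_limits_le hΨ hE hT hu h ht.1.1 le_rfl ht.1.2
  rw [intervalIntegral.integral_same] at h3
  unfold cost
  refine ⟨by linarith, by linarith, by linarith⟩

end Energy


/-! ### From the energy inequality to the inclusion, by blow-up -/

section Inclusion

variable {X : Type*} [NormedAddCommGroup X] [NormedSpace ℝ X] [FiniteDimensional ℝ X]
  {T : ℝ} {u : ℝ → X}

theorem dist_left_le (hT : 0 < T) (hu : BoundedVariationOn u (Icc 0 T)) {a b ρ : ℝ} {x : X}
    (ha : 0 ≤ a) (hab : a < b) (hb : b ≤ T) (h : ∀ r ∈ Ioo a b, dist (u r) x ≤ ρ) :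
    dist (left T u b) x ≤ ρ := by
  refine le_of_tendsto ((tendsto_left hT hu ⟨ha.trans_lt hab, hb⟩).dist tendsto_const_nhds) ?_
  filter_upwards [Ioo_mem_nhdsLT hab] with r hr using h r hr

theorem dist_right_le (hT : 0 < T) (hu : BoundedVariationOn u (Icc 0 T)) {a b ρ : ℝ} {x : X}
    (ha : 0 ≤ a) (hab : a < b) (hb : b ≤ T) (h : ∀ r ∈ Ioo a b, dist (u r) x ≤ ρ) :
    dist (right T u a) x ≤ ρ := by
  refine le_of_tendsto ((tendsto_right hT hu ⟨ha, hab.trans_le hb⟩).dist tendsto_const_nhds) ?_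
  filter_upwards [Ioo_mem_nhdsGT hab] with r hr using h r hr

/-- The rescaled increments of `u` on small intervals around `t` converge to the density. -/
theorem tendsto_increment {uL uC uJ : VectorMeasure ℝ X} {g : ℝ → X} (hT : 0 < T)
    {hu : BoundedVariationOn u (Icc 0 T)} (hdec : IsBVDecomposition hT.le hu uL uC uJ)
    (hg : IsDensity (uL + uC) (refMeasure T uC) g) {t : ℝ} (ht : t ∈ Ioo 0 T)
    (hav : Tendsto (fun r => ⨍ s in Metric.closedBall t r, g s ∂(refMeasure T uC)) (𝓝[>] 0)
      (𝓝 (g t)))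
    (hjump : Tendsto (fun r => uJ.variation (Metric.closedBall t r) /
      refMeasure T uC (Metric.closedBall t r)) (𝓝[>] 0) (𝓝 0)) :
    Tendsto (fun r => ((refMeasure T uC).real (Metric.closedBall t r))⁻¹ •
      (right T u (t + r) - left T u (t - r))) (𝓝[>] 0) (𝓝 (g t)) := by
  have hfin := isFiniteMeasure_refMeasure T uC
  have hfinJ := isFiniteMeasure_variation uJ
  have hJ : Tendsto (fun r => ((refMeasure T uC).real (Metric.closedBall t r))⁻¹ •
      uJ (Metric.closedBall t r)) (𝓝[>] 0) (𝓝 0) := by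
    have h1 := (ENNReal.tendsto_toReal ENNReal.zero_ne_top).comp hjump
    rw [ENNReal.toReal_zero] at h1
    refine squeeze_zero_norm (fun r => ?_) h1
    rw [norm_smul, norm_inv, Real.norm_of_nonneg measureReal_nonneg, Function.comp_apply,
      ENNReal.toReal_div, div_eq_inv_mul]
    exact mul_le_mul_of_nonneg_left (VectorMeasure.norm_measure_le_variation)
      (inv_nonneg.2 measureReal_nonneg)
  have h2 := hav.add hJ
  rw [add_zero] at h2
  refine h2.congr' ?_
  have hε : 0 < min t (T - t) := lt_min ht.1 (sub_pos.2 ht.2)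
  filter_upwards [Ioo_mem_nhdsGT hε] with r hr
  have hr1 := hr.2.trans_le (min_le_left _ _)
  have hr2 := hr.2.trans_le (min_le_right _ _)
  -- The increment is `u'` of the closed ball: its diffuse part is the average of `g`, and its jump
  -- part is negligible by `hJ`.
  rw [← bvDeriv_Icc hT hu (by linarith) (by linarith [hr.1]) (by linarith), hdec.sum_eq,
    _root_.add_apply, ← Real.closedBall_eq_Icc, hg.2 _ Metric.isClosed_closedBall.measurableSet,
    setAverage_eq, smul_add]

/-- Since `μ ≥ L¹`, dividing by `μ(B(t, r))` is legitimate and keeps the time length `2r` in the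
expansion error bounded. -/
theorem two_mul_le_refMeasure (uC : VectorMeasure ℝ X) {t r : ℝ} (h0 : 0 < t - r)
    (h1 : t + r < T) :
    2 * r ≤ (refMeasure T uC).real (Metric.closedBall t r) := by
  have hfin := isFiniteMeasure_refMeasure T uC
  have hb : Metric.closedBall t r ⊆ Ioo 0 T := by
    rw [Real.closedBall_eq_Icc]
    exact Icc_subset_Ioo h0 h1
  have e : volume.restrict (Ioo 0 T) (Metric.closedBall t r) = ENNReal.ofReal (2 * r) := by
    rw [Measure.restrict_apply Metric.isClosed_closedBall.measurableSet, inter_eq_left.2 hb,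
      Real.volume_closedBall]
  rw [Measure.real, ← ENNReal.ofReal_le_iff_le_toReal (measure_ne_top _ _), ← e, refMeasure,
    Measure.add_apply]
  exact le_self_add

/-- On `[t - r, t + r]` the expansion of `E` cancels the integral of `∂ₜE`, leaving `Ψ(ν) +
DE_t(u(t))(ν) ≤ η (2r + ‖ν‖)` for the increment `ν = u((t + r)₊) - u((t - r)₋)`. Dividing by `μ(B(t,
r))`, with `Ψ` homogeneous and continuous, and letting `r → 0`, then `η → 0`, gives the claim. -/
theorem density_dissipation_le {E : ℝ → X → ℝ} {Ψ : X → ℝ} (hΨ : IsGauge Ψ)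
    (hE : IsEnergy T E) (hT : 0 < T) (hu : BoundedVariationOn u (Icc 0 T))
    (h : ∀ a b, 0 ≤ a → a ≤ b → b ≤ T →
      E b (u b) + Ψ (u b - u a) ≤ E a (u a) + ∫ t in a..b, timeDeriv T E t (u t))
    {uL uC uJ : VectorMeasure ℝ X} {g : ℝ → X} (hdec : IsBVDecomposition hT.le hu uL uC uJ)
    (hg : IsDensity (uL + uC) (refMeasure T uC) g) {t : ℝ} (ht : t ∈ Ioo 0 T)
    (htJ : t ∉ jumpSet T u)
    (hav : Tendsto (fun r => ⨍ s in Metric.closedBall t r, g s ∂(refMeasure T uC)) (𝓝[>] 0)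
      (𝓝 (g t)))
    (hjump : Tendsto (fun r => uJ.variation (Metric.closedBall t r) /
      refMeasure T uC (Metric.closedBall t r)) (𝓝[>] 0) (𝓝 0)) :
    Ψ (g t) + stateDeriv E t (u t) (g t) ≤ 0 := by
  have htI := Ioo_subset_Icc_self ht
  have hq := tendsto_increment hT hdec hg ht hav hjump
  set q : ℝ → X := fun r => ((refMeasure T uC).real (Metric.closedBall t r))⁻¹ •
      (right T u (t + r) - left T u (t - r)) with hqdef
  have key : ∀ η : ℝ, 0 < η →
      Ψ (g t) + stateDeriv E t (u t) (g t) ≤ η * (1 + ‖g t‖) := by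
    intro η hη
    obtain ⟨δ, hδ, -, hexp⟩ := hE.exists_expansion_integral hT htI (u t) hη
    -- One-sided limits inherit only non-strict bounds; `δ / 2` keeps them strictly within `δ`.
    obtain ⟨ρ, hρ, hρc⟩ := Metric.continuousWithinAt_iff.1
      (continuousWithinAt_of_notMem_jumpSet hT hu ⟨htI, htJ⟩) (δ / 2) (half_pos hδ)
    refine le_of_tendsto_of_tendsto
      (((hΨ.continuous.tendsto _).comp hq).add
        (((stateDeriv E t (u t)).continuous.tendsto _).comp hq))
      ((hq.norm.const_add 1).const_mul η) ?_
    have hε : 0 < min (min t (T - t)) (min δ ρ) :=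
      lt_min (lt_min ht.1 (sub_pos.2 ht.2)) (lt_min hδ hρ)
    filter_upwards [Ioo_mem_nhdsGT hε] with r hr
    have hr0 : 0 < r := hr.1
    have hr1 : r < t := hr.2.trans_le ((min_le_left _ _).trans (min_le_left _ _))
    have hr2 : r < T - t := hr.2.trans_le ((min_le_left _ _).trans (min_le_right _ _))
    have hr3 : r < δ := hr.2.trans_le ((min_le_right _ _).trans (min_le_left _ _))
    have hr4 : r < ρ := hr.2.trans_le ((min_le_right _ _).trans (min_le_right _ _))
    have hnear : ∀ s ∈ Ioo (t - min (min t (T - t)) (min δ ρ))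
        (t + min (min t (T - t)) (min δ ρ)), dist (u s) (u t) ≤ δ / 2 := by
      intro s hs
      have a1 : min (min t (T - t)) (min δ ρ) ≤ t := (min_le_left _ _).trans (min_le_left _ _)
      have a2 : min (min t (T - t)) (min δ ρ) ≤ T - t :=
        (min_le_left _ _).trans (min_le_right _ _)
      have a3 : min (min t (T - t)) (min δ ρ) ≤ ρ := (min_le_right _ _).trans (min_le_right _ _)
      refine (hρc (x := s) ⟨by linarith [hs.1], by linarith [hs.2]⟩ ?_).le
      rw [Real.dist_eq, abs_lt]
      constructor <;> linarith [hs.1, hs.2]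
    set ε := min (min t (T - t)) (min δ ρ)
    have a1 : ε ≤ t := (min_le_left _ _).trans (min_le_left _ _)
    have a2 : ε ≤ T - t := (min_le_left _ _).trans (min_le_right _ _)
    have hrε : r < ε := hr.2
    have hleft : dist (left T u (t - r)) (u t) ≤ δ / 2 :=
      dist_left_le hT hu (a := t - ε) (by linarith) (by linarith) (by linarith)
        fun s hs => hnear s ⟨hs.1, by linarith [hs.2]⟩
    have hright : dist (right T u (t + r)) (u t) ≤ δ / 2 :=
      dist_right_le hT hu (b := t + ε) (by linarith) (by linarith) (by linarith)
        fun s hs => hnear s ⟨by linarith [hs.1], hs.2⟩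
    have m1 : t - r ∈ Icc 0 T := ⟨by linarith, by linarith⟩
    have m2 : t + r ∈ Icc 0 T := ⟨by linarith, by linarith⟩
    have h1 := hexp (t - r) m1 (t + r) m2 (left T u (t - r)) (right T u (t + r)) (by linarith)
      (by rw [Real.dist_eq, abs_lt]; constructor <;> linarith)
      (by rw [Real.dist_eq, abs_lt]; constructor <;> linarith)
      (by linarith) (by linarith) u
      (fun s hs => (hnear s ⟨by linarith [hs.1], by linarith [hs.2]⟩).trans_lt (by linarith))
      (intervalIntegrable_timeDeriv hE hT hu m1 m2)
    have h2 := one_sided_limits_le hΨ hE hT hu h m1.1 (by linarith) m2.2 (a := t - r) (b := t + r)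
    have hM := two_mul_le_refMeasure (T := T) uC (t := t) (r := r) (by linarith) (by linarith)
    change Ψ (q r) + stateDeriv E t (u t) (q r) ≤ η * (1 + ‖q r‖)
    rw [hqdef]
    beta_reduce
    set M := (refMeasure T uC).real (Metric.closedBall t r)
    set ν := right T u (t + r) - left T u (t - r)
    have hM0 : 0 < M := by linarith
    rw [hΨ.smul _ _ (inv_nonneg.2 hM0.le), map_smul, smul_eq_mul, norm_smul, norm_inv,
      Real.norm_of_nonneg hM0.le, ← mul_add, inv_mul_le_iff₀ hM0]
    have e : M * (η * (1 + M⁻¹ * ‖ν‖)) = η * (M + ‖ν‖) := by field_simp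
    rw [e]
    have h3 : η * (2 * r) ≤ η * M := mul_le_mul_of_nonneg_left hM hη.le
    linarith [(abs_le.1 h1).1]
  refine le_of_forall_pos_le_add fun ε hε => ?_
  have hpos : 0 < 1 + ‖g t‖ := by positivity
  have := key (ε / (1 + ‖g t‖)) (by positivity)
  rwa [div_mul_cancel₀ _ hpos.ne', ← zero_add ε] at this

theorem bvInclusion_of_energy {E : ℝ → X → ℝ} {Ψ : X → ℝ} (hΨ : IsGauge Ψ)
    (hE : IsEnergy T E) (hT : 0 < T) (hu : BoundedVariationOn u (Icc 0 T))
    (hst : ∀ t ∈ Icc 0 T \ jumpSet T u, -stateDeriv E t (u t) ∈ stableSet Ψ)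
    (h : ∀ a b, 0 ≤ a → a ≤ b → b ≤ T →
      E b (u b) + Ψ (u b - u a) ≤ E a (u a) + ∫ t in a..b, timeDeriv T E t (u t)) :
    BVInclusion hT.le Ψ E hu := by
  have := FiniteDimensional.complete ℝ X
  obtain ⟨uL, uC, uJ, g, hdec, hg, hO⟩ := exists_isBVDecomposition hT hu
  have hfin := isFiniteMeasure_refMeasure T uC
  refine ⟨uL, uC, uJ, g, hdec, hg, ?_⟩
  have hav := (Besicovitch.vitaliFamily (refMeasure T uC)).ae_tendsto_average
    hg.1.locallyIntegrable
  have hJ : ∀ᵐ t ∂(refMeasure T uC), t ∉ jumpSet T u :=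
    compl_mem_ae_iff.2 (hdec.refMeasure_jumpSet hT)
  have hI : ∀ᵐ t ∂(refMeasure T uC), t ∈ Ioo 0 T := mem_ae_iff.2 hO
  filter_upwards [hav, hJ, hI, hdec.ae_tendsto_jump hT] with t h1 h2 h3 h4
  refine ⟨-stateDeriv E t (u t), hΨ.mem_subdifferential_iff.2
    ⟨hst t ⟨Ioo_subset_Icc_self h3, h2⟩, ?_⟩, neg_add_cancel _⟩
  have := density_dissipation_le hΨ hE hT hu h hdec hg h3 h2
    (h1.comp (Besicovitch.tendsto_filterAt _ t)) h4
  rw [_root_.neg_apply]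
  linarith

end Inclusion


/-- Real induction for transitive relations: a relation which holds locally, on both sides of
every point, holds globally. -/
theorem forall_of_local {T : ℝ} {P : ℝ → ℝ → Prop} (hrefl : ∀ a, P a a)
    (htrans : ∀ a b c, 0 ≤ a → a ≤ b → b ≤ c → c ≤ T → P a b → P b c → P a c)
    (hright : ∀ t ∈ Ico 0 T, ∀ᶠ b in 𝓝[>] t, P t b)
    (hleft : ∀ t ∈ Ioc 0 T, ∀ᶠ a in 𝓝[<] t, P a t)
    {a b : ℝ} (ha : 0 ≤ a) (hab : a ≤ b) (hb : b ≤ T) : P a b := by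
  set S := {c | c ∈ Icc a b ∧ P a c} with hS
  have haS : a ∈ S := ⟨⟨le_rfl, hab⟩, hrefl a⟩
  have hbdd : BddAbove S := ⟨b, fun c hc => hc.1.2⟩
  set c := sSup S with hc
  have hac : a ≤ c := le_csSup hbdd haS
  have hcb : c ≤ b := csSup_le ⟨a, haS⟩ fun x hx => hx.1.2
  have hPc : P a c := by
    rcases hac.eq_or_lt with h | h
    · rw [← h]; exact hrefl a
    obtain ⟨l, hl, hlP⟩ := (mem_nhdsLT_iff_exists_Ioo_subset' h).1
      (hleft c ⟨ha.trans_lt h, hcb.trans hb⟩)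
    obtain ⟨s, hs, hls⟩ := exists_lt_of_lt_csSup ⟨a, haS⟩ (show l < sSup S from hl)
    rcases (le_csSup hbdd hs).eq_or_lt with h' | h'
    · rw [hc, ← h']; exact hs.2
    · exact htrans a s c ha hs.1.1 h'.le (hcb.trans hb) hs.2 (hlP ⟨hls, h'⟩)
  rcases hcb.eq_or_lt with h | h
  · rwa [← h]
  · exfalso
    have h1 := (hright c ⟨ha.trans hac, h.trans_le hb⟩).and (Ioo_mem_nhdsGT h)
    obtain ⟨d, hd1, hd2⟩ := h1.exists
    have : d ∈ S := ⟨⟨hac.trans hd2.1.le, hd2.2.le⟩,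
      htrans a c d ha hac hd2.1.le (hd2.2.le.trans hb) hPc hd1⟩
    exact absurd (le_csSup hbdd this) (not_le.2 hd2.1)

/-! ### From the inclusion and the jump inequalities to the energy inequality -/

section Energy

variable {X : Type*} [NormedAddCommGroup X] [NormedSpace ℝ X]
  {T : ℝ} {u : ℝ → X} {E : ℝ → X → ℝ} {Ψ : X → ℝ}

/-- Off the jump set all three are trivial equalities, so later arguments need not ask whether an
end point is a jump. -/
theorem JumpInequalities.forall_mem_Icc (h : JumpInequalities T Ψ E u) (hΨ : IsGauge Ψ) {t : ℝ}
    (ht : t ∈ Icc 0 T) :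
    E t (u t) + Ψ (u t - left T u t) ≤ E t (left T u t) ∧
    E t (right T u t) + Ψ (right T u t - u t) ≤ E t (u t) ∧
    E t (right T u t) + Ψ (right T u t - left T u t) ≤ E t (left T u t) := by
  by_cases hJ : t ∈ jumpSet T u
  · obtain ⟨h1, h2, h3⟩ := h t hJ
    unfold cost at h1 h2 h3
    exact ⟨by linarith, by linarith, by linarith⟩
  · rw [left_eq_of_notMem ⟨ht, hJ⟩, right_eq_of_notMem ⟨ht, hJ⟩]
    simp [hΨ.map_zero]

variable [FiniteDimensional ℝ X]

/-- A set of full measure in `(0, T)` is dense in `[0, T]`; off the jump set `s ↦ -DE_s(u(s))` is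
continuous, and `K*` is closed. -/
theorem stable_of_ae (hE : IsEnergy T E) (hT : 0 < T) (hu : BoundedVariationOn u (Icc 0 T))
    (h : ∀ᵐ t ∂(volume.restrict (Ioo 0 T)), -stateDeriv E t (u t) ∈ stableSet Ψ) {t : ℝ}
    (ht : t ∈ Icc 0 T \ jumpSet T u) : -stateDeriv E t (u t) ∈ stableSet Ψ := by
  rw [ae_restrict_iff' measurableSet_Ioo] at h
  have hd := Measure.dense_of_ae h
  have hmem : t ∈ closure (Ioo 0 T ∩
      {s | s ∈ Ioo 0 T → -stateDeriv E s (u s) ∈ stableSet Ψ}) := by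
    have h1 := closure_mono (hd.open_subset_closure_inter (isOpen_Ioo (a := 0) (b := T)))
    rw [closure_closure, closure_Ioo hT.ne] at h1
    exact h1 ht.1
  have hc : ContinuousWithinAt (fun s => -stateDeriv E s (u s)) (Icc 0 T) t :=
    ((hE.continuousOn_stateDeriv hT (t, u t) ⟨ht.1, mem_univ _⟩).comp_of_eq
      (continuousWithinAt_id.prodMk (continuousWithinAt_of_notMem_jumpSet hT hu ht))
      (fun r hr => ⟨hr, mem_univ _⟩) rfl).neg
  have h2 := (hc.mono (inter_subset_left.trans Ioo_subset_Icc_self)).mem_closure hmem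
    (show MapsTo _ _ (stableSet Ψ) from fun s hs => hs.2 hs.1)
  rwa [isClosed_stableSet.closure_eq] at h2

/-- A bound on the atoms of a vector measure gives a bound on countable sets. -/
theorem apply_le_of_forall_singleton (ν : VectorMeasure ℝ X) {S : Set ℝ} (hS : S.Countable)
    (ℓ : StrongDual ℝ X) {η : ℝ} (h : ∀ s ∈ S, ℓ (ν {s}) ≤ η * ν.variation.real {s}) :
    ℓ (ν S) ≤ η * ν.variation.real S := by
  have hfin := isFiniteMeasure_variation ν
  -- The difference of the two sides is a signed measure, nonnegative on the atoms in `S`, hence on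
  -- `S` by countable additivity.
  let τ : SignedMeasure ℝ := η • ν.variation.toSignedMeasure -
    ν.mapRange ℓ.toLinearMap.toAddMonoidHom ℓ.continuous
  have hτ : ∀ A, MeasurableSet A → τ A = η * ν.variation.real A - ℓ (ν A) := fun A hA => by
    change η • ν.variation.toSignedMeasure A - ℓ (ν A) = _
    rw [Measure.toSignedMeasure_apply_measurable hA, smul_eq_mul]
  have := hS.to_subtype
  have h1 := VectorMeasure.of_iUnion_nonneg (v := τ) (f := fun s : S => ({(s : ℝ)} : Set ℝ))
    (fun s => measurableSet_singleton _)
    (fun a b hab => disjoint_singleton.2 fun h => hab (Subtype.ext h))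
    (fun s => by
      rw [hτ _ (measurableSet_singleton _)]
      exact sub_nonneg.2 (h s s.2))
  rw [iUnion_singleton_eq_range, Subtype.range_coe, hτ _ hS.measurableSet] at h1
  linarith

/-- The measure which controls the errors in the chain rule. -/
noncomputable def errorMeasure (T : ℝ) (uC uJ : VectorMeasure ℝ X) (g : ℝ → X) : Measure ℝ :=
  volume.restrict (Ioo 0 T) + (refMeasure T uC).withDensity (fun t => ‖g t‖ₑ) + uJ.variation

theorem isFiniteMeasure_errorMeasure {uC uJ : VectorMeasure ℝ X} {g : ℝ → X}
    (hg : Integrable g (refMeasure T uC)) : IsFiniteMeasure (errorMeasure T uC uJ g) := by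
  have h1 := isFiniteMeasure_variation uJ
  have h2 : IsFiniteMeasure ((refMeasure T uC).withDensity (fun t => ‖g t‖ₑ)) :=
    isFiniteMeasure_withDensity hg.2.ne
  unfold errorMeasure
  infer_instance

theorem errorMeasure_real_Ioo {uC uJ : VectorMeasure ℝ X} {g : ℝ → X}
    (hg : Integrable g (refMeasure T uC)) {a b : ℝ} (ha : 0 ≤ a) (hab : a ≤ b) (hb : b ≤ T) :
    (errorMeasure T uC uJ g).real (Ioo a b) =
      (b - a) + (∫ t in Ioo a b, ‖g t‖ ∂(refMeasure T uC)) + uJ.variation.real (Ioo a b) := by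
  have h1 := isFiniteMeasure_variation uJ
  have h2 : IsFiniteMeasure ((refMeasure T uC).withDensity (fun t => ‖g t‖ₑ)) :=
    isFiniteMeasure_withDensity hg.2.ne
  rw [errorMeasure, measureReal_add_apply, measureReal_add_apply]
  congr 2
  · rw [measureReal_restrict_apply measurableSet_Ioo,
      inter_eq_left.2 (Ioo_subset_Ioo ha hb), Real.volume_real_Ioo_of_le hab]
  · rw [integral_norm_eq_lintegral_enorm hg.1.restrict, Measure.real,
      withDensity_apply _ measurableSet_Ioo]

/-- The energy inequality, up to a small error, on an open interval where `u` oscillates little. -/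
theorem energy_le_on_cell (hΨ : IsGauge Ψ) (hE : IsEnergy T E) (hT : 0 < T)
    {hu : BoundedVariationOn u (Icc 0 T)} (hjump : JumpInequalities T Ψ E u)
    {uL uC uJ : VectorMeasure ℝ X} {g : ℝ → X} (hdec : IsBVDecomposition hT.le hu uL uC uJ)
    (hg : IsDensity (uL + uC) (refMeasure T uC) g)
    (hdiss : ∀ᵐ t ∂(refMeasure T uC), Ψ (g t) + stateDeriv E t (u t) (g t) ≤ 0)
    {w : StrongDual ℝ X} (hw : w ∈ stableSet Ψ) {t₀ : ℝ} (ht₀ : t₀ ∈ Icc 0 T) (x₀ : X)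
    {η : ℝ} (hη : 0 < η) :
    ∃ δ > 0, ∀ a b, 0 ≤ a → a < b → b ≤ T → dist a t₀ < δ → dist b t₀ < δ →
      (∀ r ∈ Ioo a b, dist (u r) x₀ ≤ δ / 2) →
      E b (left T u b) + w (left T u b) ≤ E a (right T u a) + w (right T u a) +
        (∫ t in a..b, timeDeriv T E t (u t)) +
        2 * η * (errorMeasure T uC uJ g).real (Ioo a b) := by
  have := FiniteDimensional.complete ℝ X
  obtain ⟨δ, hδ, hderiv, hexp⟩ := hE.exists_expansion_integral hT ht₀ x₀ hη
  refine ⟨δ, hδ, fun a b ha hab hb had hbd hnear => ?_⟩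
  have hfin := isFiniteMeasure_refMeasure T uC
  have hfinJ := isFiniteMeasure_variation uJ
  set L := stateDeriv E t₀ x₀
  set I := Ioo a b with hI
  have hd : ∀ r ∈ I, dist r t₀ < δ := fun r hr => by
    rw [Real.dist_eq, abs_lt] at *
    constructor <;> linarith [hr.1, hr.2]
  have hmem : ∀ r ∈ I, r ∈ Icc 0 T := fun r hr => ⟨ha.trans hr.1.le, hr.2.le.trans hb⟩
  have hleft : ∀ r ∈ Ioc a b, dist (left T u r) x₀ < δ := fun r hr =>
    (dist_left_le hT hu ha hr.1 (hr.2.trans hb)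
      fun s hs => hnear s ⟨hs.1, hs.2.trans_le hr.2⟩).trans_lt (half_lt_self hδ)
  have hright : ∀ r ∈ Ico a b, dist (right T u r) x₀ < δ := fun r hr =>
    (dist_right_le hT hu (ha.trans hr.1) hr.2 hb
      fun s hs => hnear s ⟨hr.1.trans_lt hs.1, hs.2⟩).trans_lt (half_lt_self hδ)
  -- Expanding from `u(a₊)` to `u(b₋)` leaves only what happens inside the cell; the jumps at `a`
  -- and `b` are treated separately.
  have hchain := hexp a ⟨ha, hab.le.trans hb⟩ b ⟨ha.trans hab.le, hb⟩ (right T u a)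
    (left T u b) hab.le had hbd (hright a ⟨le_rfl, hab⟩) (hleft b ⟨hab, le_rfl⟩) u
    (fun r hr => (hnear r hr).trans_lt (half_lt_self hδ))
    (intervalIntegrable_timeDeriv hE hT hu ⟨ha, hab.le.trans hb⟩ ⟨ha.trans hab.le, hb⟩)
  have hν : left T u b - right T u a = (∫ t in I, g t ∂(refMeasure T uC)) + uJ I := by
    rw [← bvDeriv_Ioo hT hu ha hab hb, hdec.sum_eq, _root_.add_apply, hg.2 _ measurableSet_Ioo]
  -- Pointwise `w(g) ≤ Ψ(g) ≤ -DE_t(u(t))(g)`, and replacing `DE_t(u(t))` by the frozen `L` costs `η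
  -- ‖g‖`.
  have hco : (L + w) (∫ t in I, g t ∂(refMeasure T uC)) ≤
      η * ∫ t in I, ‖g t‖ ∂(refMeasure T uC) := by
    rw [← ContinuousLinearMap.integral_comp_comm _ hg.1.integrableOn, ← integral_const_mul]
    refine setIntegral_mono_on_ae ((L + w).integrable_comp hg.1).integrableOn
      (hg.1.norm.const_mul η).integrableOn measurableSet_Ioo ?_
    filter_upwards [hdiss] with t h1 htI
    have h2 := (hderiv t (hmem t htI) (u t) (hd t htI)
      ((hnear t htI).trans_lt (half_lt_self hδ)))
    have h3 := (abs_le.1 (((stateDeriv E t (u t) - L).le_opNorm (g t)).trans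
      (mul_le_mul_of_nonneg_right h2 (norm_nonneg _)))).1
    have h4 := hw (g t)
    rw [_root_.sub_apply] at h3
    rw [_root_.add_apply]
    linarith
  have hJ : (L + w) (uJ I) ≤ η * uJ.variation.real I := by
    have hS := measurableSet_essJumpSet hT hu
    rw [hdec.jump_apply hS measurableSet_Ioo]
    refine (apply_le_of_forall_singleton uJ (((countable_jumpSet hT hu).mono
      essJumpSet_subset_jumpSet).mono inter_subset_right) _ (η := η) ?_).trans
      (mul_le_mul_of_nonneg_left (measureReal_mono inter_subset_left) hη.le)
    rintro s ⟨hs, -⟩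
    have hs' : s ∈ Ioo 0 T := ⟨ha.trans_lt hs.1, hs.2.trans_le hb⟩
    have h1 := VectorMeasure.norm_measure_le_variation (μ := uJ) (E := {s})
    rw [hdec.jump_singleton, bvDeriv_singleton hT hu hs'] at *
    have h2 := (hjump.forall_mem_Icc hΨ (hmem s hs)).2.2
    -- The expansion at the single time `s`, between the two one-sided limits: the integral is zero
    -- and the condition along the curve is empty. With the third jump inequality it bounds each
    -- atom.
    have h3 := hexp s (hmem s hs) s (hmem s hs) (left T u s) (right T u s) le_rfl (hd s hs)
      (hd s hs) (hleft s ⟨hs.1, hs.2.le⟩) (hright s ⟨hs.1.le, hs.2⟩) u (by simp) (by simp)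
    rw [intervalIntegral.integral_same, sub_self, zero_add] at h3
    have h4 := (abs_le.1 h3).1
    have h5 := hw (right T u s - left T u s)
    have h6 := mul_le_mul_of_nonneg_left h1 hη.le
    rw [_root_.add_apply]
    linarith
  have hnorm : ‖left T u b - right T u a‖ ≤
      (∫ t in I, ‖g t‖ ∂(refMeasure T uC)) + uJ.variation.real I := by
    rw [hν]
    exact (norm_add_le _ _).trans (add_le_add (norm_integral_le_integral_norm _)
      VectorMeasure.norm_measure_le_variation)
  -- The factor `2`: one `η` comes from the expansion error, the other from the bounds `hco` and
  -- `hJ`.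
  rw [errorMeasure_real_Ioo hg.1 ha hab.le hb]
  have h1 : (L + w) (left T u b - right T u a) ≤ η * (∫ t in I, ‖g t‖ ∂(refMeasure T uC)) +
      η * uJ.variation.real I := by
    rw [hν, map_add]
    exact add_le_add hco hJ
  have h2 := mul_le_mul_of_nonneg_left hnorm hη.le
  have h3 := (abs_le.1 hchain).2
  have h4 : 0 ≤ η * (b - a) := mul_nonneg hη.le (sub_nonneg.2 hab.le)
  rw [_root_.add_apply, map_sub w] at h1
  linarith

/-- The linear `w` attains `Ψ` on the one increment `u(b) - u(a)` and is dominated by `Ψ` on all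
others. Being additive, it lets the cell estimates be chained with total error at most `2η m((a,
b))`. -/
theorem energy_of_bvInclusion (hΨ : IsGauge Ψ) (hE : IsEnergy T E) (hT : 0 < T)
    {hu : BoundedVariationOn u (Icc 0 T)} (hjump : JumpInequalities T Ψ E u)
    {uL uC uJ : VectorMeasure ℝ X} {g : ℝ → X} (hdec : IsBVDecomposition hT.le hu uL uC uJ)
    (hg : IsDensity (uL + uC) (refMeasure T uC) g)
    (hdiss : ∀ᵐ t ∂(refMeasure T uC), Ψ (g t) + stateDeriv E t (u t) (g t) ≤ 0)
    {a b : ℝ} (ha : 0 ≤ a) (hab : a ≤ b) (hb : b ≤ T) :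
    E b (u b) + Ψ (u b - u a) ≤ E a (u a) + ∫ t in a..b, timeDeriv T E t (u t) := by
  obtain ⟨w, hw, hwΨ⟩ := hΨ.exists_mem_stableSet_apply_eq (u b - u a)
  have hfin := isFiniteMeasure_errorMeasure (uJ := uJ) hg.1
  set m := errorMeasure T uC uJ g
  have key : ∀ η : ℝ, 0 < η → E b (u b) + w (u b) ≤ E a (u a) + w (u a) +
      (∫ t in a..b, timeDeriv T E t (u t)) + 2 * η * m.real (Ioo a b) := by
    intro η hη
    refine forall_of_local (T := T) (P := fun a b => E b (u b) + w (u b) ≤ E a (u a) + w (u a) +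
      (∫ t in a..b, timeDeriv T E t (u t)) + 2 * η * m.real (Ioo a b)) (by simp)
      ?_ ?_ ?_ ha hab hb
    · intro p q r hp hpq hqr hr h1 h2
      have hp' : p ∈ Icc 0 T := ⟨hp, hpq.trans (hqr.trans hr)⟩
      have hq' : q ∈ Icc 0 T := ⟨hp.trans hpq, hqr.trans hr⟩
      have hr' : r ∈ Icc 0 T := ⟨hq'.1.trans hqr, hr⟩
      have e := intervalIntegral.integral_add_adjacent_intervals
        (intervalIntegrable_timeDeriv hE hT hu hp' hq')
        (intervalIntegrable_timeDeriv hE hT hu hq' hr')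
      -- Superadditivity suffices: the point `q`, possibly an atom of `m`, is left out, its jump
      -- being paid for by the inequalities at end points.
      have h3 : m.real (Ioo p q) + m.real (Ioo q r) ≤ m.real (Ioo p r) := by
        rw [← measureReal_union (Set.disjoint_left.2 fun x hx hx' => lt_asymm hx.2 hx'.1)
          measurableSet_Ioo]
        exact measureReal_mono (union_subset (Ioo_subset_Ioo_right hqr) (Ioo_subset_Ioo_left hpq))
      have h4 := mul_le_mul_of_nonneg_left h3 (by positivity : 0 ≤ 2 * η)
      linarith
    · intro t ht
      -- Freezing at `u(t₊)` to the right of `t`, and at `u(t₋)` to the left, covers jump times too: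
      -- `u` oscillates little on each open side.
      obtain ⟨δ, hδ, hcell⟩ := energy_le_on_cell hΨ hE hT hjump hdec hg hdiss hw
        (Ico_subset_Icc_self ht) (right T u t) hη
      have hnear := (tendsto_right hT hu ht).eventually
        (Metric.closedBall_mem_nhds _ (half_pos hδ))
      obtain ⟨l, hl, hlP⟩ := mem_nhdsGT_iff_exists_Ioo_subset.1 hnear
      filter_upwards [Ioo_mem_nhdsGT hl, Ioo_mem_nhdsGT ht.2,
        Ioo_mem_nhdsGT (lt_add_of_pos_right t hδ)] with s h1 h2 h3
      have h4 := hcell t s ht.1 h1.1 h2.2.le (by simpa using hδ)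
        (by rw [Real.dist_eq, abs_lt]; constructor <;> linarith [h3.1, h3.2])
        (fun r hr => hlP ⟨hr.1, hr.2.trans h1.2⟩)
      -- The cell estimate runs from `u(t₊)` to `u(s₋)`; the missing jumps at `t` and `s` are
      -- absorbed by the pointwise jump inequalities, using `w ≤ Ψ`.
      have h5 := (hjump.forall_mem_Icc hΨ (Ico_subset_Icc_self ht)).2.1
      have h6 := (hjump.forall_mem_Icc hΨ ⟨ht.1.trans h2.1.le, h2.2.le⟩).1
      have h7 := hw (right T u t - u t)
      have h8 := hw (u s - left T u s)
      rw [map_sub] at h7 h8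
      linarith
    · intro t ht
      obtain ⟨δ, hδ, hcell⟩ := energy_le_on_cell hΨ hE hT hjump hdec hg hdiss hw
        (Ioc_subset_Icc_self ht) (left T u t) hη
      have hnear := (tendsto_left hT hu ht).eventually
        (Metric.closedBall_mem_nhds _ (half_pos hδ))
      obtain ⟨l, hl, hlP⟩ := mem_nhdsLT_iff_exists_Ioo_subset.1 hnear
      filter_upwards [Ioo_mem_nhdsLT hl, Ioo_mem_nhdsLT ht.1,
        Ioo_mem_nhdsLT (sub_lt_self t hδ)] with s h1 h2 h3
      have h4 := hcell s t h2.1.le h1.2 ht.2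
        (by rw [Real.dist_eq, abs_lt]; constructor <;> linarith [h3.1, h3.2])
        (by simpa using hδ) (fun r hr => hlP ⟨h1.1.trans hr.1, hr.2⟩)
      have h5 := (hjump.forall_mem_Icc hΨ ⟨h2.1.le, h2.2.le.trans ht.2⟩).2.1
      have h6 := (hjump.forall_mem_Icc hΨ (Ioc_subset_Icc_self ht)).1
      have h7 := hw (right T u s - u s)
      have h8 := hw (u t - left T u t)
      rw [map_sub] at h7 h8
      linarith
  rw [← hwΨ, map_sub]
  refine le_of_forall_pos_le_add fun ε hε => ?_
  have hpos : 0 < 2 * (m.real (Ioo a b) + 1) := by positivity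
  have h1 := key (ε / (2 * (m.real (Ioo a b) + 1))) (by positivity)
  have h2 : 2 * (ε / (2 * (m.real (Ioo a b) + 1))) * m.real (Ioo a b) ≤ ε := by
    rw [mul_div_assoc', mul_div_mul_left _ _ two_ne_zero, div_mul_eq_mul_div,
      div_le_iff₀ (by positivity)]
    nlinarith [measureReal_nonneg (μ := m) (s := Ioo a b)]
  linarith

theorem isLocalSolution_iff (hT : 0 < T) (hΨ : IsGauge Ψ) (hE : IsEnergy T E)
    (hu : BoundedVariationOn u (Icc 0 T)) :
    IsLocalSolution T Ψ E u ↔ BVInclusion hT.le Ψ E hu ∧ JumpInequalities T Ψ E u := by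
  constructor
  · rintro ⟨-, hst, hen⟩
    have h := (energy_inequality_iff hΨ hE hT hu).1 hen
    exact ⟨bvInclusion_of_energy hΨ hE hT hu hst h, jumpInequalities_of_energy hΨ hE hT hu h⟩
  · rintro ⟨⟨uL, uC, uJ, g, hdec, hg, hincl⟩, hjump⟩
    have hsub : ∀ᵐ t ∂(refMeasure T uC), -stateDeriv E t (u t) ∈ subdifferential Ψ (g t) := by
      filter_upwards [hincl] with t ⟨w, hw, h0⟩
      rwa [← eq_neg_of_add_eq_zero_left h0]
    refine ⟨hu, fun t ht => stable_of_ae hE hT hu ?_ ht,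
      (energy_inequality_iff hΨ hE hT hu).2 fun a b ha hab hb =>
        energy_of_bvInclusion hΨ hE hT hjump hdec hg ?_ ha hab hb⟩
    -- Since `μ ≥ L¹`, stability `μ`-a.e. holds Lebesgue-a.e., hence on a dense set.
    · have hle : volume.restrict (Ioo 0 T) ≤ refMeasure T uC := Measure.le_add_right le_rfl
      filter_upwards [ae_mono hle hsub] with t h
      exact hΨ.mem_stableSet_of_mem_subdifferential h
    · filter_upwards [hsub] with t h
      have := (hΨ.mem_subdifferential_iff.1 h).2
      rw [_root_.neg_apply] at this
      linarith

end Energy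

end RIS

theorem proposition2p4 {X : Type*} [NormedAddCommGroup X] [NormedSpace ℝ X]
    [FiniteDimensional ℝ X] {T : ℝ} (hT : 0 < T) (Ψ : X → ℝ) (hΨ : RIS.IsGauge Ψ)
    (E : ℝ → X → ℝ) (hE : RIS.IsEnergy T E)
    (u : ℝ → X) (hu : BoundedVariationOn u (Set.Icc 0 T)) :
    RIS.IsLocalSolution T Ψ E u ↔
      RIS.BVInclusion hT.le Ψ E hu ∧ RIS.JumpInequalities T Ψ E u :=
  RIS.isLocalSolution_iff hT hΨ hE hu
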